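/- Let $0\le q<r\le n$ be integers. Consider the system $\dot Z=\mathcal A Z+\mathcal B U+\mathcal F(t)$, $t\ge 0$, $Z(0)=Z_0\in\mathbb R^n$, $U\in\mathbb R^r$, with cost $\int_0^\infty (Z^T\mathcal D Z+U^TGU)\,dt$, where $\mathcal A,\mathcal B,\mathcal D$ are constant real matrices, $\mathcal D$ is symmetric, $G=\mathrm{diag}(g_1,\dots,g_q,0,\dots,0)$ and $\mathcal F$ is measurable. Write $\mathcal B=(\mathcal B_1,\mathcal B_2)$ with $\mathcal B_1$ of size $n\times q$ and $\mathcal B_2$ of size $n\times(r-q)$. Assume: (A1) $\mathcal B$ has rank $r$; (A2) $\mathcal D\ge 0$; (A3) $g_k>0$ for $k=1,\dots,q$; (A4) $\|\mathcal F(t)\|\le a e^{-\gamma t}$ for $t\ge0$, with some $a,\gamma>0$; (A5) $\det(\mathcal B_2^T\mathcal D\mathcal B_2)\ne0$. Let $\mathcal B_c$ be any $n\times(n-r)$ matrix such that $(\mathcal B_c,\mathcal B)$ is nonsingular. Put $\widetilde{\mathcal B}_c=(\mathcal B_c,\mathcal B_1)$, $D_2=\mathcal B_2^T\mathcal D\mathcal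 B_2$, $\mathcal H=D_2^{-1}\mathcal B_2^T\mathcal D\widetilde{\mathcal B}_c$, $\mathcal L=\widetilde{\mathcal B}_c-\mathcal B_2\mathcal H$, $T=(\mathcal L,\mathcal B_2)$, $D_1=\mathcal L^T\mathcal D\mathcal L$, and $$A=T^{-1}\mathcal A T=\begin{pmatrix}A_1&A_2\\A_3&A_4\end{pmatrix},\quad B=T^{-1}\mathcal B,\quad D=T^T\mathcal D T,\quad f=T^{-1}\mathcal F=\begin{pmatrix}f_1\\f_2\end{pmatrix},\quad z_0=T^{-1}Z_0=\begin{pmatrix}x_0\\y_0\end{pmatrix},$$ partitioned according to $n=(n-r+q)+(r-q)$. Put also $\widetilde G=\mathrm{diag}(g_1,\dots,g_q)$ and $$\bar B=\left(\begin{pmatrix}0_{(n-r)\times q}\\ I_q\end{pmatrix},A_2\right),\quad \Theta=\begin{pmatrix}\widetilde G&0\\0&D_2\end{pmatrix},\quad S_0=A_2D_2^{-1}A_2^T+\begin{pmatrix}0&0\\0&\widetilde G^{-1}\end{pmatrix}=\bar B\Theta^{-1}\bar B^T.$$ Let $F_1$ be a matrix with $D_1=F_1^TF_1$, and assume further: (A6)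 $(A_1,\bar B)$ is stabilizable; (A7) $(A_1,F_1)$ is detectable. The problem (OOCP) is to minimize $J=\int_0^\infty(z^TDz+u^TGu)\,dt$ subject to $\dot z=Az+Bu+f$, $z(0)=z_0$. The reduced problem (ROCP) is to minimize $\bar J=\int_0^\infty(\bar x^TD_1\bar x+\bar u^T\Theta\bar u)\,dt$ subject to $\dot{\bar x}=A_1\bar x+\bar B\bar u+f_1$, $\bar x(0)=x_0$. In both problems an admissible control is a state feedback $u(w,t)$ that is measurable in $t\ge 0$ for each fixed $w$ and locally Lipschitz in $w$ uniformly in $t\ge0$, for which the closed-loop initial-value problem has a unique locally absolutely continuous solution on $[0,\infty)$, and for which both this solution and the control along it belong to $L^2[0,\infty)$. Then the Riccati equation $PA_1+A_1^TP-PS_0P+D_1=0$ has a unique symmetric solution $P_{10}^*\ge0$, and $\mathcal A_0=A_1-S_0P_{10}^*$ is Hurwitz. On $[0,\infty)$ the terminal-value problems $$\dot h_{10}=-\mathcal A_0^Th_{10}-P_{10}^*f_1,\quad h_{10}(+\infty)=0;\qquad \dot s_0=-2h_{10}^Tf_1+h_{10}^TS_0h_{10},\quad s_0(+\infty)=0$$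 have unique locally absolutely continuous solutions (the equations holding for almost every $t$). The set of admissible controls of (OOCP) is nonempty, the infimum $J^*$ of $J$ over it is finite, and $$J^*=\bar J^*:=x_0^TP_{10}^*x_0+2h_{10}(0)^Tx_0+s_0(0).$$ Moreover, $\bar J^*$ is the optimal value of (ROCP): it is the minimum of $\bar J$ over the admissible controls of (ROCP), and this minimum is attained. -/

import Mathlib

open MeasureTheory Filter Topology Set
open scoped Matrix NNReal

noncomputable section

namespace SingularLQ

/-! ### General notions -/

/-- Local absolute continuity on `[0, +∞)`: absolute continuity on every `[0, T]`. -/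
def LocAC {E : Type*} [PseudoMetricSpace E] (z : ℝ → E) : Prop :=
  ∀ T : ℝ, 0 ≤ T → AbsolutelyContinuousOnInterval z 0 T

/-- A real square matrix is Hurwitz if all its complex eigenvalues have negative real part. -/
def IsHurwitz {ι : Type*} [Fintype ι] [DecidableEq ι] (M : Matrix ι ι ℝ) : Prop :=
  ∀ μ ∈ spectrum ℂ (M.map (algebraMap ℝ ℂ)), μ.re < 0

/-- Stabilizability of the pair `(A, B)`: some state feedback makes `A + B K` Hurwitz. -/
def IsStabilizable {ι κ : Type*} [Fintype ι] [DecidableEq ι] [Fintype κ]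
    (A : Matrix ι ι ℝ) (B : Matrix ι κ ℝ) : Prop :=
  ∃ K : Matrix κ ι ℝ, IsHurwitz (A + B * K)

/-- Detectability of the pair `(A, C)`: some output injection makes `A + N C` Hurwitz. -/
def IsDetectable {ι κ : Type*} [Fintype ι] [DecidableEq ι] [Fintype κ]
    (A : Matrix ι ι ℝ) (C : Matrix κ ι ℝ) : Prop :=
  ∃ N : Matrix ι κ ℝ, IsHurwitz (A + N * C)

/-- Data of an infinite-horizon linear-quadratic problem with a known disturbance:
`z' = A z + B u + f(t)` for `t ≥ 0`, `z(0) = z0`, with cost `∫₀^∞ (zᵀ Q z + uᵀ R u) dt`.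
State and control spaces carry the sup norm, which is equivalent to the Euclidean norm; all
notions below are unaffected by passing to an equivalent norm. -/
structure LQProblem (ι κ : Type*) where
  A : Matrix ι ι ℝ
  B : Matrix ι κ ℝ
  f : ℝ → ι → ℝ
  z0 : ι → ℝ
  Q : Matrix ι ι ℝ
  R : Matrix κ κ ℝ

namespace LQProblem

variable {ι κ : Type*} [Fintype ι] [Fintype κ]

/-- The class of functions `p(w, t)`, `t ≥ 0`, that are (Lebesgue) measurable in `t` for every
fixed `w` and satisfy a local Lipschitz condition in `w`, uniformly in `t ≥ 0`. -/
def IsFeedback (p : (ι → ℝ) → ℝ → (κ → ℝ)) : Prop :=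
  (∀ w, AEStronglyMeasurable (fun t => p w t) (volume.restrict (Ici 0))) ∧
  ∀ w₀, ∃ K : ℝ≥0, ∃ V ∈ 𝓝 w₀, ∀ t : ℝ, 0 ≤ t → LipschitzOnWith K (fun w => p w t) V

/-- `z` is a locally absolutely continuous solution on `[0, +∞)` of the closed-loop
initial-value problem under the state feedback `u`. -/
def IsTrajectory (P : LQProblem ι κ) (u : (ι → ℝ) → ℝ → (κ → ℝ)) (z : ℝ → ι → ℝ) : Prop :=
  LocAC z ∧ z 0 = P.z0 ∧
  ∀ᵐ t ∂(volume.restrict (Ici (0 : ℝ))),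
    HasDerivAt z (P.A *ᵥ z t + P.B *ᵥ u (z t) t + P.f t) t

/-- Admissible state-feedback controls: `u` is in the class above; (a) the closed-loop problem
has a solution on `[0, +∞)`, unique there; (b) this solution is in `L²`; (c) so is the control
along it. -/
def IsAdmissible (P : LQProblem ι κ) (u : (ι → ℝ) → ℝ → (κ → ℝ)) : Prop :=
  IsFeedback u ∧
  ∃ z : ℝ → ι → ℝ, P.IsTrajectory u z ∧
    (∀ z' : ℝ → ι → ℝ, P.IsTrajectory u z' → EqOn z' z (Ici 0)) ∧
    MemLp z 2 (volume.restrict (Ici 0)) ∧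
    MemLp (fun t => u (z t) t) 2 (volume.restrict (Ici 0))

/-- The quadratic cost of the feedback `u` along the trajectory `z`. -/
def cost (P : LQProblem ι κ) (u : (ι → ℝ) → ℝ → (κ → ℝ)) (z : ℝ → ι → ℝ) : ℝ :=
  ∫ t in Ici (0 : ℝ), (z t ⬝ᵥ P.Q *ᵥ z t + u (z t) t ⬝ᵥ P.R *ᵥ u (z t) t)

/-- The set of values `J(u)` of the cost over all admissible state-feedback controls `u`
(each evaluated along the trajectory that `u` generates). -/
def costValues (P : LQProblem ι κ) : Set ℝ :=
  {c | ∃ u z, P.IsAdmissible u ∧ P.IsTrajectory u z ∧ c = P.cost u z}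

end LQProblem

/-! ### The singular problem and the objects built from its data

The state dimension is `n = m + q + p` and the control dimension is `r = q + p`; coordinates are
labelled by disjoint unions so that the block partitions are visible. -/

/-- Labels of the `n - r + q = m + q` slow coordinates. -/
abbrev XIdx (m q : ℕ) := Fin m ⊕ Fin q

/-- Labels of the `n = m + q + p` state coordinates. -/
abbrev ZIdx (m q p : ℕ) := XIdx m q ⊕ Fin p

/-- Labels of the `r = q + p` control coordinates: `q` regular ones, then `p` singular ones. -/
abbrev UIdx (q p : ℕ) := Fin q ⊕ Fin p

/-- Data of the initial problem `Z' = 𝒜 Z + ℬ U + ℱ(t)`, `Z(0) = Z0`, with cost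
`∫₀^∞ (Zᵀ 𝒟 Z + Uᵀ G U) dt`, `G = diag(g₁, …, g_q, 0, …, 0)`, and a matrix `calBc` with which
`ℬ` is to be completed to a nonsingular square matrix. -/
structure Data (m q p : ℕ) where
  calA : Matrix (ZIdx m q p) (ZIdx m q p) ℝ
  calB : Matrix (ZIdx m q p) (UIdx q p) ℝ
  calD : Matrix (ZIdx m q p) (ZIdx m q p) ℝ
  g : Fin q → ℝ
  calF : ℝ → ZIdx m q p → ℝ
  Z0 : ZIdx m q p → ℝ
  calBc : Matrix (ZIdx m q p) (Fin m) ℝ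

namespace Data

variable {m q p : ℕ} (d : Data m q p)

/-- The first `q` columns of `ℬ`. -/
def calB1 : Matrix (ZIdx m q p) (Fin q) ℝ := d.calB.toCols₁

/-- The last `r - q = p` columns of `ℬ`. -/
def calB2 : Matrix (ZIdx m q p) (Fin p) ℝ := d.calB.toCols₂

/-- `(ℬ_c, ℬ₁)`. -/
def tildeBc : Matrix (ZIdx m q p) (XIdx m q) ℝ := Matrix.fromCols d.calBc d.calB1

/-- `(ℬ_c, ℬ) = (ℬ_c, ℬ₁, ℬ₂)`, a square matrix. -/
def fullB : Matrix (ZIdx m q p) (ZIdx m q p) ℝ := Matrix.fromCols d.tildeBc d.calB2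

/-- `D₂ = ℬ₂ᵀ 𝒟 ℬ₂`. -/
def D2 : Matrix (Fin p) (Fin p) ℝ := d.calB2ᵀ * d.calD * d.calB2

/-- `ℋ = (ℬ₂ᵀ 𝒟 ℬ₂)⁻¹ ℬ₂ᵀ 𝒟 (ℬ_c, ℬ₁)`. -/
def calH : Matrix (Fin p) (XIdx m q) ℝ := d.D2⁻¹ * d.calB2ᵀ * d.calD * d.tildeBc

/-- `ℒ = (ℬ_c, ℬ₁) - ℬ₂ ℋ`. -/
def calL : Matrix (ZIdx m q p) (XIdx m q) ℝ := d.tildeBc - d.calB2 * d.calH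

/-- The transformation matrix `(ℒ, ℬ₂)`. -/
def T : Matrix (ZIdx m q p) (ZIdx m q p) ℝ := Matrix.fromCols d.calL d.calB2

/-- `G = diag(g₁, …, g_q, 0, …, 0)`. -/
def G : Matrix (UIdx q p) (UIdx q p) ℝ := Matrix.diagonal (Sum.elim d.g 0)

/-- `A = (ℒ, ℬ₂)⁻¹ 𝒜 (ℒ, ℬ₂)`. -/
def A : Matrix (ZIdx m q p) (ZIdx m q p) ℝ := d.T⁻¹ * d.calA * d.T

/-- `B = (ℒ, ℬ₂)⁻¹ ℬ`. -/
def B : Matrix (ZIdx m q p) (UIdx q p) ℝ := d.T⁻¹ * d.calB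

/-- `D = (ℒ, ℬ₂)ᵀ 𝒟 (ℒ, ℬ₂)`. -/
def D : Matrix (ZIdx m q p) (ZIdx m q p) ℝ := d.Tᵀ * d.calD * d.T

/-- `f(t) = (ℒ, ℬ₂)⁻¹ ℱ(t)`. -/
def f (t : ℝ) : ZIdx m q p → ℝ := d.T⁻¹ *ᵥ d.calF t

/-- `z0 = (ℒ, ℬ₂)⁻¹ Z0`. -/
def z0 : ZIdx m q p → ℝ := d.T⁻¹ *ᵥ d.Z0

/-- The original optimal control problem (OOCP): the initial problem in the new state
`z = (ℒ, ℬ₂)⁻¹ Z`. -/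
def oocp : LQProblem (ZIdx m q p) (UIdx q p) where
  A := d.A
  B := d.B
  f := d.f
  z0 := d.z0
  Q := d.D
  R := d.G

/-- Upper left block of `A`. -/
def A1 : Matrix (XIdx m q) (XIdx m q) ℝ := d.A.toBlocks₁₁

/-- Upper right block of `A`. -/
def A2 : Matrix (XIdx m q) (Fin p) ℝ := d.A.toBlocks₁₂

/-- `D₁ = ℒᵀ 𝒟 ℒ`. -/
def D1 : Matrix (XIdx m q) (XIdx m q) ℝ := d.calLᵀ * d.calD * d.calL

/-- Upper block of the disturbance `f`. -/
def f1 (t : ℝ) : XIdx m q → ℝ := fun i => d.f t (Sum.inl i)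

/-- Upper block of `z0`. -/
def x0 : XIdx m q → ℝ := fun i => d.z0 (Sum.inl i)

/-- `B̃ = (0; I_q)` and `B̄ = (B̃, A₂)`. -/
def barB : Matrix (XIdx m q) (UIdx q p) ℝ :=
  Matrix.fromCols (Matrix.fromRows (0 : Matrix (Fin m) (Fin q) ℝ) 1) d.A2

/-- `Θ = diag(G̃, D₂)`, `G̃ = diag(g₁, …, g_q)`. -/
def Theta : Matrix (UIdx q p) (UIdx q p) ℝ :=
  Matrix.fromBlocks (Matrix.diagonal d.g) 0 0 d.D2

/-- `S₁ = diag(0, G̃⁻¹)`. -/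
def S1 : Matrix (XIdx m q) (XIdx m q) ℝ :=
  Matrix.fromBlocks 0 0 0 (Matrix.diagonal d.g)⁻¹

/-- `S₀ = A₂ D₂⁻¹ A₂ᵀ + S₁`. -/
def S0 : Matrix (XIdx m q) (XIdx m q) ℝ := d.A2 * d.D2⁻¹ * d.A2ᵀ + d.S1

/-- The reduced optimal control problem (ROCP):
`x' = A₁ x + B̄ u + f₁(t)`, `x(0) = x0`, with cost `∫₀^∞ (xᵀ D₁ x + uᵀ Θ u) dt`. -/
def rocp : LQProblem (XIdx m q) (UIdx q p) where
  A := d.A1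
  B := d.barB
  f := d.f1
  z0 := d.x0
  Q := d.D1
  R := d.Theta

/-- `P` is a symmetric positive semi-definite solution of the reduced algebraic Riccati equation
`P A₁ + A₁ᵀ P - P S₀ P + D₁ = 0`. -/
def IsRiccatiSol (P : Matrix (XIdx m q) (XIdx m q) ℝ) : Prop :=
  P.PosSemidef ∧ P * d.A1 + d.A1ᵀ * P - P * d.S0 * P + d.D1 = 0

/-- `h` solves, on `[0, +∞)`, the terminal-value problem
`h' = -(A₁ - S₀ P)ᵀ h - P f₁(t)`, `h(+∞) = 0`. -/
def IsHSol (P : Matrix (XIdx m q) (XIdx m q) ℝ) (h : ℝ → XIdx m q → ℝ) : Prop :=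
  LocAC h ∧
  (∀ᵐ t ∂(volume.restrict (Ici (0 : ℝ))),
    HasDerivAt h (-((d.A1 - d.S0 * P)ᵀ *ᵥ h t) - P *ᵥ d.f1 t) t) ∧
  Tendsto h atTop (𝓝 0)

/-- `s` solves, on `[0, +∞)`, the terminal-value problem
`s' = -2 hᵀ f₁ + hᵀ S₀ h`, `s(+∞) = 0`. -/
def IsSSol (h : ℝ → XIdx m q → ℝ) (s : ℝ → ℝ) : Prop :=
  LocAC s ∧
  (∀ᵐ t ∂(volume.restrict (Ici (0 : ℝ))),
    HasDerivAt s (-2 * (h t ⬝ᵥ d.f1 t) + h t ⬝ᵥ d.S0 *ᵥ h t) t) ∧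
  Tendsto s atTop (𝓝 0)

end Data

end SingularLQ

end

/-!
The transformation `z = (ℒ, ℬ₂)⁻¹ Z` splits the state into a slow part `x` and a fast part `y`.
The cost has no cross term in `x` and `y` (`Data.D_eq`), the singular controls enter only the
equation of `y`, and `y` enters the equation of `x` and the cost exactly as a control does. Hence
a trajectory of the singular problem with regular controls `u₁` is a trajectory of the reduced
problem with control `(u₁, y)`, at the same cost (`Data.oocp_rhs_inl`, `Data.oocp_cost_eq`).

For the reduced problem, completion of squares (`integral_cost_eq`) shows that every
square-integrable pair of state and control costs `x₀ᵀ P x₀ + 2 h(0)ᵀ x₀ + s(0) + ∫ (v - v*)ᵀ Θ (v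
- v*)`, where `v* = -Θ⁻¹ B̄ᵀ (P x + h)`. The boundary term at infinity vanishes because `xᵀ P x +
2 hᵀ x` is integrable and converges. This gives the lower bound for both problems, and the minimum
for the reduced one, where the feedback `v*` is admissible. In the singular problem `y` is a state
and cannot be set equal to the second component `y*` of `v*`, but the singular controls can be
chosen such that the deviation `e = y - y*` satisfies `e' = -c e` exactly, for any `c > 0`
(`Data.fast_deviation_eq`); in `e'` the disturbance of `x` cancels against the one in the equation
of `h`, so that no differentiability of the disturbance is needed. The cost then exceeds the bound
by `e(0)ᵀ D₂ e(0) / (2c)`, which tends to zero as `c → ∞`.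

The Riccati equation is solved in `exists_riccati_eq_zero`: among the positive semi-definite
subsolutions, a set that stabilizability makes nonempty, one of minimal trace is a solution, since
a Newton step from it stays in the set and does not increase the trace. Detectability makes the
closed loop of every positive semi-definite subsolution Hurwitz (`isHurwitz_of_riccati`), whence
uniqueness by a Sylvester equation. All stability arguments rest on the exponential decay of `exp
(tM)` for a Hurwitz matrix `M` (`IsHurwitz.flow_bound`), which comes from Gelfand's formula.
-/

noncomputable section

namespace SingularLQ

/-! ### Exponential decay of the flow of a Hurwitz matrix -/

section Exponential

variable {E : Type*} [NormedAddCommGroup E] [NormedSpace ℂ E] [FiniteDimensional ℂ E]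

theorem exp_apply_of_eigenvector {F : Type*} [NormedAddCommGroup F] [NormedSpace ℂ F]
    [CompleteSpace F] {L : F →L[ℂ] F} {μ : ℂ} {w : F} (h : L w = μ • w) :
    NormedSpace.exp L w = Complex.exp μ • w := by
  have h1 := (NormedSpace.exp_series_hasSum_exp' (𝕂 := ℂ) L).map
    (ContinuousLinearMap.apply ℂ F w) (ContinuousLinearMap.apply ℂ F w).continuous
  have h2 := (NormedSpace.exp_series_hasSum_exp' (𝕂 := ℂ) μ).smul_const w
  have hp : ∀ n : ℕ, (L ^ n) w = μ ^ n • w := by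
    intro n
    induction n with
    | zero => simp
    | succ n ih => rw [pow_succ', mul_apply_eq_comp, ih, map_smul, h, smul_smul,
        pow_succ]
  rw [Complex.exp_eq_exp_ℂ]
  refine h1.unique ?_
  convert h2 using 2 with n
  simp [hp, smul_smul]

theorem norm_lt_one_of_mem_spectrum_exp {L : E →L[ℂ] E}
    (hL : ∀ (μ : ℂ) (w : E), w ≠ 0 → L w = μ • w → μ.re < 0) {z : ℂ}
    (hz : z ∈ spectrum ℂ (NormedSpace.exp L)) : ‖z‖ < 1 := by
  have : CompleteSpace E := FiniteDimensional.complete ℂ E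
  let X : E →L[ℂ] E := NormedSpace.exp L
  let φ := Module.End.toContinuousLinearMap (𝕜 := ℂ) E
  have hz' : z ∈ spectrum ℂ (φ.symm X) := by
    rw [AlgEquiv.spectrum_eq]; exact hz
  have hev := Module.End.hasEigenvalue_iff_mem_spectrum.2 hz'
  have hX : ∀ w, φ.symm X w = X w := fun w => rfl
  -- The eigenspace is invariant under `L`, so it contains an eigenvector of `L`.
  have hcomm : Commute L X := (Commute.refl L).exp_right
  have hinv : ∀ w ∈ Module.End.eigenspace (φ.symm X) z,
      (L : E →ₗ[ℂ] E) w ∈ Module.End.eigenspace (φ.symm X) z := by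
    intro w hw
    rw [Module.End.mem_eigenspace_iff, hX] at hw ⊢
    have := congrArg (fun A : E →L[ℂ] E => A w) hcomm.eq
    simp only [mul_apply_eq_comp] at this
    simp [← this, hw]
  have : Nontrivial (Module.End.eigenspace (φ.symm X) z) :=
    (Submodule.nontrivial_iff_ne_bot).2 hev
  obtain ⟨μ, hμ⟩ := Module.End.exists_eigenvalue ((L : E →ₗ[ℂ] E).restrict hinv)
  obtain ⟨w, hw⟩ := hμ.exists_hasEigenvector
  have hw1 : L (w : E) = μ • (w : E) := congrArg Subtype.val hw.apply_eq_smul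
  have hw0 : (w : E) ≠ 0 := fun h => hw.2 (Subtype.ext h)
  have h1 : X (w : E) = z • (w : E) := by
    have := w.2
    rwa [Module.End.mem_eigenspace_iff, hX] at this
  have h2 : X (w : E) = Complex.exp μ • (w : E) := exp_apply_of_eigenvector hw1
  have h3 : z = Complex.exp μ := smul_left_injective ℂ hw0 (h1.symm.trans h2)
  rw [h3, Complex.norm_exp]
  exact (Real.exp_lt_exp.2 (hL μ w hw0 hw1)).trans_eq Real.exp_zero

theorem exists_norm_pow_lt_one {A : Type*} [NormedRing A] [NormedAlgebra ℂ A] [CompleteSpace A]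
    (a : A) (ha : ∀ z ∈ spectrum ℂ a, ‖z‖ < 1) : ∃ n : ℕ, 0 < n ∧ ‖a ^ n‖ < 1 := by
  rcases subsingleton_or_nontrivial A with h | h
  · exact ⟨1, one_pos, by rw [Subsingleton.elim (a ^ 1) 0]; simp⟩
  have h1 : spectralRadius ℂ a < (1 : ℝ≥0) := spectrum.spectralRadius_lt_of_forall_lt a
    fun z hz => by exact_mod_cast ha z hz
  have h2 := (spectrum.pow_norm_pow_one_div_tendsto_nhds_spectralRadius a).eventually_lt_const h1
  obtain ⟨n, hn, hn0⟩ := (h2.and (eventually_gt_atTop 0)).exists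
  refine ⟨n, hn0, ?_⟩
  by_contra hcon
  push Not at hcon
  have : (1 : ℝ) ≤ ‖a ^ n‖ ^ (1 / n : ℝ) := Real.one_le_rpow hcon (by positivity)
  have h3 := ENNReal.ofReal_le_ofReal this
  simp only [ENNReal.ofReal_one, ENNReal.coe_one] at h3 hn
  exact absurd hn (not_lt.2 h3)

/-- If all eigenvalues of `L` have negative real part, then the semigroup `exp (tL)` decays
exponentially: some power of `exp L` is a strict contraction by Gelfand's formula. -/
theorem exists_norm_exp_smul_le (L : E →L[ℂ] E)
    (hL : ∀ (μ : ℂ) (w : E), w ≠ 0 → L w = μ • w → μ.re < 0) :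
    ∃ C α : ℝ, 0 < C ∧ 0 < α ∧ ∀ t : ℝ, 0 ≤ t →
      ‖NormedSpace.exp (t • L)‖ ≤ C * Real.exp (-α * t) := by
  have : CompleteSpace E := FiniteDimensional.complete ℂ E
  let +nondep : NormedAlgebra ℚ (E →L[ℂ] E) := .restrictScalars ℚ ℂ _
  obtain ⟨n, hn, hlt⟩ := exists_norm_pow_lt_one (NormedSpace.exp L)
    fun z => norm_lt_one_of_mem_spectrum_exp hL
  have hcont : Continuous fun t : ℝ => NormedSpace.exp (t • L) :=
    NormedSpace.exp_continuous.comp (continuous_id.smul continuous_const)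
  obtain ⟨C, hC⟩ := (isCompact_Icc (a := (0 : ℝ)) (b := n)).exists_bound_of_continuousOn
    hcont.continuousOn
  -- `ρ` is positive, so that its logarithm makes sense.
  obtain ⟨ρ, hρ1, hρ2⟩ : ∃ ρ : ℝ, max ‖NormedSpace.exp L ^ n‖ 2⁻¹ = ρ ∧ ρ < 1 :=
    ⟨_, rfl, max_lt hlt (by norm_num)⟩
  have hρ0 : 0 < ρ := by rw [← hρ1]; positivity
  have hn' : (0 : ℝ) < n := by exact_mod_cast hn
  have hlog : Real.log ρ < 0 := Real.log_neg hρ0 hρ2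
  have hC0 : 0 ≤ C := (norm_nonneg _).trans (hC 0 ⟨le_rfl, hn'.le⟩)
  refine ⟨(C + 1) / ρ, -Real.log ρ / n, by positivity, div_pos (by linarith) hn', fun t ht => ?_⟩
  let j := ⌊t / n⌋₊
  have hj1 : (j : ℝ) ≤ t / n := Nat.floor_le (by positivity)
  have hj2 : t / n < j + 1 := Nat.lt_floor_add_one _
  rw [le_div_iff₀ hn'] at hj1
  rw [div_lt_iff₀ hn'] at hj2
  have hsplit : NormedSpace.exp (t • L) =
      (NormedSpace.exp L ^ n) ^ j * NormedSpace.exp ((t - j * n) • L) := by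
    rw [← pow_mul, ← NormedSpace.exp_nsmul, ← NormedSpace.exp_add_of_commute]
    · congr 1
      rw [← Nat.cast_smul_eq_nsmul ℝ, ← add_smul]
      push_cast
      ring_nf
    · exact ((Commute.refl L).smul_left _).smul_right _
  have h1 : ‖(NormedSpace.exp L ^ n) ^ j * NormedSpace.exp ((t - j * n) • L)‖ ≤
      ρ ^ j * C := by
    rcases Nat.eq_zero_or_pos j with h0 | h0
    · rw [h0]
      simpa using hC (t - j * n) ⟨by linarith, by linarith⟩ |>.trans_eq' (by simp [h0])
    · refine (norm_mul_le _ _).trans (mul_le_mul ?_ (hC _ ⟨by linarith, by linarith⟩)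
        (norm_nonneg _) (by positivity))
      refine (norm_pow_le' _ h0).trans ?_
      gcongr
      exact hρ1 ▸ le_max_left _ _
  rw [hsplit]
  refine h1.trans ?_
  have h2 : ρ ^ j = Real.exp (j * Real.log ρ) := by
    rw [mul_comm, Real.exp_mul, Real.exp_log hρ0, Real.rpow_natCast]
  have h3 : Real.exp (-(-Real.log ρ / n) * t) / ρ = Real.exp (Real.log ρ * (t / n - 1)) := by
    rw [← Real.exp_log hρ0, ← Real.exp_sub, Real.log_exp]
    congr 1
    field_simp
  rw [div_mul_eq_mul_div, mul_div_assoc, h3, h2, mul_comm]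
  refine mul_le_mul (by linarith) (Real.exp_le_exp.2 ?_) (Real.exp_pos _).le (by linarith)
  rw [mul_comm]
  refine mul_le_mul_of_nonpos_left ?_ hlog.le
  have : t / n < j + 1 := Nat.lt_floor_add_one _
  linarith

end Exponential

/-! ### Hurwitz matrices and their flow -/

variable {ι κ : Type*} [Fintype ι] [DecidableEq ι] [Fintype κ]

/-- The Hurwitz property in real terms: a real and an imaginary part `a`, `b` of an eigenvector
for an eigenvalue `σ + iω` with `σ ≥ 0` must vanish. -/
theorem isHurwitz_iff {M : Matrix ι ι ℝ} : IsHurwitz M ↔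
    ∀ (σ ω : ℝ) (a b : ι → ℝ), 0 ≤ σ → M *ᵥ a = σ • a - ω • b → M *ᵥ b = ω • a + σ • b →
      a = 0 ∧ b = 0 := by
  have key : ∀ v : ι → ℂ, ∀ μ : ℂ, (M.map (algebraMap ℝ ℂ)) *ᵥ v = μ • v ↔
      (M *ᵥ (fun i => (v i).re) = μ.re • (fun i => (v i).re) - μ.im • (fun i => (v i).im) ∧
      M *ᵥ (fun i => (v i).im) = μ.im • (fun i => (v i).re) + μ.re • (fun i => (v i).im)) := by
    intro v μ
    simp only [funext_iff, ← forall_and]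
    refine forall_congr' fun i => ?_
    rw [Complex.ext_iff]
    simp only [Matrix.mulVec, dotProduct, Matrix.map_apply, Complex.re_sum, Complex.im_sum,
      Complex.mul_re, Complex.mul_im, Pi.smul_apply, smul_eq_mul, Pi.sub_apply, Pi.add_apply,
      Complex.coe_algebraMap, Complex.ofReal_re, Complex.ofReal_im, zero_mul, sub_zero, add_zero]
    rw [add_comm (μ.re * _)]
  constructor
  · intro h σ ω a b hσ ha hb
    by_contra hab
    let v : ι → ℂ := fun i => ⟨a i, b i⟩
    have hv : (M.map (algebraMap ℝ ℂ)) *ᵥ v = (⟨σ, ω⟩ : ℂ) • v := (key v _).2 ⟨ha, hb⟩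
    have hv0 : v ≠ 0 := by
      intro h0
      exact hab ⟨funext fun i => congrArg Complex.re (congrFun h0 i),
        funext fun i => congrArg Complex.im (congrFun h0 i)⟩
    have : (⟨σ, ω⟩ : ℂ) ∈ spectrum ℂ (M.map (algebraMap ℝ ℂ)) := by
      rw [← Matrix.spectrum_toLin', ← Module.End.hasEigenvalue_iff_mem_spectrum]
      exact Module.End.hasEigenvalue_of_hasEigenvector
        ⟨Module.End.mem_eigenspace_iff.2 (by simpa using hv), hv0⟩
    exact absurd (h _ this) (not_lt.2 hσ)
  · intro h μ hμ
    rw [← Matrix.spectrum_toLin', ← Module.End.hasEigenvalue_iff_mem_spectrum] at hμ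
    obtain ⟨v, hv⟩ := hμ.exists_hasEigenvector
    by_contra hre
    have h1 := hv.apply_eq_smul
    rw [Matrix.toLin'_apply, key] at h1
    obtain ⟨h2, h3⟩ := h _ _ _ _ (not_lt.1 hre) h1.1 h1.2
    exact hv.2 (funext fun i => Complex.ext (congrFun h2 i) (congrFun h3 i))

theorem IsHurwitz.transpose {M : Matrix ι ι ℝ} (h : IsHurwitz M) : IsHurwitz Mᵀ := by
  intro μ hμ
  refine h μ ?_
  rw [Matrix.mem_spectrum_iff_isRoot_charpoly] at hμ ⊢
  rwa [Matrix.transpose_map, Matrix.charpoly_transpose] at hμ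

/-- The flow `exp (tM)` of the linear differential equation `x' = M x`. -/
def flow (M : Matrix ι ι ℝ) (t : ℝ) : (ι → ℝ) →L[ℝ] (ι → ℝ) :=
  NormedSpace.exp (t • LinearMap.toContinuousLinearMap (Matrix.toLin' M))

theorem hasDerivAt_flow (M : Matrix ι ι ℝ) (t : ℝ) : HasDerivAt (flow M)
    (flow M t * LinearMap.toContinuousLinearMap (Matrix.toLin' M)) t :=
  hasDerivAt_exp_smul_const (LinearMap.toContinuousLinearMap (Matrix.toLin' M)) t

theorem flow_mulVec (M : Matrix ι ι ℝ) (t : ℝ) (v : ι → ℝ) :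
    flow M t (M *ᵥ v) = M *ᵥ flow M t v := by
  have h : Commute (flow M t) (LinearMap.toContinuousLinearMap (Matrix.toLin' M)) :=
    ((Commute.refl _).smul_right t).exp_right.symm
  simpa using congrArg (fun A : (ι → ℝ) →L[ℝ] (ι → ℝ) => A v) h.eq

theorem hasDerivAt_flow_apply (M : Matrix ι ι ℝ) (t : ℝ) (v : ι → ℝ) :
    HasDerivAt (fun s => flow M s v) (M *ᵥ flow M t v) t := by
  have := (hasDerivAt_flow M t).clm_apply (hasDerivAt_const t v)
  simpa [flow_mulVec] using this

@[simp] theorem flow_zero (M : Matrix ι ι ℝ) : flow M 0 = 1 := by simp [flow]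

theorem flow_add (M : Matrix ι ι ℝ) (s t : ℝ) : flow M (s + t) = flow M s * flow M t := by
  let +nondep : NormedAlgebra ℚ ((ι → ℝ) →L[ℝ] (ι → ℝ)) := .restrictScalars ℚ ℝ _
  rw [flow, add_smul, NormedSpace.exp_add_of_commute]
  · rfl
  · exact ((Commute.refl _).smul_left _).smul_right _

theorem flow_apply_flow (M : Matrix ι ι ℝ) (s t : ℝ) (v : ι → ℝ) :
    flow M s (flow M t v) = flow M (s + t) v := by rw [flow_add]; rfl

theorem flow_neg (M : Matrix ι ι ℝ) (s : ℝ) : flow (-M) s = flow M (-s) := by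
  unfold flow
  congr 1
  ext
  simp

theorem continuous_flow (M : Matrix ι ι ℝ) : Continuous (flow M) :=
  continuous_iff_continuousAt.2 fun t => (hasDerivAt_flow M t).continuousAt

theorem contDiff_flow (M : Matrix ι ι ℝ) : ContDiff ℝ 1 (flow M) := by
  rw [contDiff_one_iff_deriv]
  refine ⟨fun t => (hasDerivAt_flow M t).differentiableAt, ?_⟩
  rw [funext fun t => (hasDerivAt_flow M t).deriv]
  exact (continuous_flow M).mul continuous_const

theorem IsHurwitz.flow_bound {M : Matrix ι ι ℝ} (h : IsHurwitz M) :
    ∃ C α : ℝ, 0 < C ∧ 0 < α ∧ ∀ t : ℝ, 0 ≤ t → ∀ v,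
      ‖flow M t v‖ ≤ C * Real.exp (-α * t) * ‖v‖ := by
  let L : (ι → ℂ) →L[ℂ] (ι → ℂ) :=
    LinearMap.toContinuousLinearMap (Matrix.toLin' (M.map (algebraMap ℝ ℂ)))
  have hLapp : ∀ w, L w = (M.map (algebraMap ℝ ℂ)) *ᵥ w := fun w => rfl
  obtain ⟨C, α, hC, hα, hb⟩ := exists_norm_exp_smul_le L (by
    intro μ w hw hLw
    refine h μ ?_
    rw [← Matrix.spectrum_toLin', ← Module.End.hasEigenvalue_iff_mem_spectrum]
    exact Module.End.hasEigenvalue_of_hasEigenvector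
      ⟨Module.End.mem_eigenspace_iff.2 hLw, hw⟩)
  refine ⟨C, α, hC, hα, fun t ht v => ?_⟩
  let J : (ι → ℝ) →L[ℝ] (ι → ℂ) := ContinuousLinearMap.pi fun i =>
    Complex.ofRealCLM.comp (ContinuousLinearMap.proj i)
  have hJ : ∀ x i, J x i = (x i : ℂ) := fun x i => rfl
  have hJn : ∀ x, ‖J x‖ = ‖x‖ := fun x => by
    simp [Pi.norm_def, hJ]
  have hLJ : ∀ x, L (J x) = J (M *ᵥ x) := fun x => by
    ext i
    simp [hLapp, hJ, Matrix.mulVec, dotProduct]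
  -- Both exponential series have the same image of `v`, term by term.
  have h1 := (NormedSpace.exp_series_hasSum_exp' (𝕂 := ℝ) (t • L)).map
    (ContinuousLinearMap.apply ℂ (ι → ℂ) (J v)) (ContinuousLinearMap.apply ℂ _ (J v)).continuous
  have h2 := ((NormedSpace.exp_series_hasSum_exp' (𝕂 := ℝ)
    (t • LinearMap.toContinuousLinearMap (Matrix.toLin' M))).map
    (ContinuousLinearMap.apply ℝ (ι → ℝ) v) (ContinuousLinearMap.apply ℝ _ v).continuous).map
    J J.continuous
  have hp : ∀ n : ℕ, ((t • L) ^ n) (J v) =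
      J (((t • LinearMap.toContinuousLinearMap (Matrix.toLin' M)) ^ n) v) := by
    intro n
    induction n with
    | zero => simp
    | succ n ih =>
      rw [pow_succ', mul_apply_eq_comp, ih, pow_succ', mul_apply_eq_comp]
      simp [hLJ]
  have h3 : NormedSpace.exp (t • L) (J v) = J (flow M t v) := by
    refine h1.unique (Eq.mp (congrArg (fun f => HasSum f _) (funext fun n => ?_)) h2)
    symm
    change ((n.factorial : ℝ)⁻¹ • (t • L) ^ n) (J v) = J (((n.factorial : ℝ)⁻¹ •
      (t • LinearMap.toContinuousLinearMap (Matrix.toLin' M)) ^ n) v)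
    rw [smul_apply, smul_apply, hp, map_smul]
  rw [← hJn, ← h3, ← hJn v]
  exact (ContinuousLinearMap.le_opNorm _ _).trans (by gcongr; exact hb t ht)

/-! ### Locally absolutely continuous functions -/

section LocAC

variable {ι κ : Type*} [Fintype ι] [Fintype κ]
variable {E F : Type*} [NormedAddCommGroup E] [NormedAddCommGroup F]

theorem LocAC.add {z w : ℝ → E} (hz : LocAC z) (hw : LocAC w) : LocAC fun t => z t + w t :=
  fun T hT => (hz T hT).add (hw T hT)

theorem LocAC.sub {z w : ℝ → E} (hz : LocAC z) (hw : LocAC w) : LocAC fun t => z t - w t :=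
  fun T hT => (hz T hT).sub (hw T hT)

theorem LocAC.smul [NormedSpace ℝ E] {z : ℝ → ℝ} {w : ℝ → E} (hz : LocAC z) (hw : LocAC w) :
    LocAC fun t => z t • w t :=
  fun T hT => (hz T hT).smul (hw T hT)

theorem ContDiff.locAC [NormedSpace ℝ E] {z : ℝ → E} (hz : ContDiff ℝ 1 z) : LocAC z :=
  fun _ _ => hz.contDiffOn.absolutelyContinuousOnInterval

theorem locAC_const [NormedSpace ℝ E] (c : E) : LocAC fun _ => c := ContDiff.locAC contDiff_const

theorem LocAC.sum [NormedSpace ℝ E] {α : Type*} (s : Finset α) {z : α → ℝ → E}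
    (hz : ∀ i ∈ s, LocAC (z i)) :
    LocAC fun t => ∑ i ∈ s, z i t := by
  classical
  induction s using Finset.induction_on with
  | empty => simpa using locAC_const (0 : E)
  | insert a s ha ih =>
    simp only [Finset.sum_insert ha]
    exact (hz a (Finset.mem_insert_self a s)).add
      (ih fun i hi => hz i (Finset.mem_insert_of_mem hi))

theorem LocAC.clm [NormedSpace ℝ E] [NormedSpace ℝ F] {z : ℝ → E} (hz : LocAC z)
    (L : E →L[ℝ] F) : LocAC fun t => L (z t) := by
  intro T hT
  have h := hz T hT
  unfold AbsolutelyContinuousOnInterval at h ⊢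
  refine squeeze_zero (fun t => Finset.sum_nonneg fun i _ => dist_nonneg) (fun t => ?_)
    (by simpa using h.const_mul ‖L‖)
  rw [Finset.mul_sum]
  exact Finset.sum_le_sum fun i _ => L.lipschitz.dist_le_mul _ _

theorem locAC_pi {z : ℝ → ι → ℝ} (hz : ∀ i, LocAC fun t => z t i) : LocAC z := by
  intro T hT
  have h := fun i => hz i T hT
  unfold AbsolutelyContinuousOnInterval at h ⊢
  refine squeeze_zero (fun t => Finset.sum_nonneg fun i _ => dist_nonneg) (fun t => ?_)
    (by simpa using tendsto_finsetSum Finset.univ fun i _ => h i)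
  rw [Finset.sum_comm]
  refine Finset.sum_le_sum fun j _ => (dist_pi_le_iff (Finset.sum_nonneg fun _ _ =>
    dist_nonneg)).2 fun i => ?_
  exact Finset.single_le_sum
    (f := fun i => dist (z (t.2 j).1 i) (z (t.2 j).2 i)) (fun _ _ => dist_nonneg)
    (Finset.mem_univ i)

theorem LocAC.apply {z : ℝ → ι → ℝ} (hz : LocAC z) (i : ι) : LocAC fun t => z t i :=
  hz.clm (ContinuousLinearMap.proj (R := ℝ) (φ := fun _ : ι => ℝ) i)

theorem LocAC.mulVec {z : ℝ → ι → ℝ} (hz : LocAC z) (M : Matrix κ ι ℝ) :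
    LocAC fun t => M *ᵥ z t :=
  hz.clm (LinearMap.toContinuousLinearMap M.mulVecLin)

theorem LocAC.dotProduct {z w : ℝ → ι → ℝ} (hz : LocAC z) (hw : LocAC w) :
    LocAC fun t => z t ⬝ᵥ w t :=
  LocAC.sum _ fun i _ => (hz.apply i).smul (hw.apply i)

theorem LocAC.continuousOn {z : ℝ → E} (hz : LocAC z) : ContinuousOn z (Ici 0) := by
  intro t ht
  have ht' : (0 : ℝ) ≤ t := ht
  have h := (hz (t + 1) (by linarith)).continuousOn
  rw [uIcc_of_le (by linarith)] at h
  refine (h t ⟨ht, by linarith⟩).mono_of_mem_nhdsWithin ?_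
  rw [mem_nhdsWithin]
  exact ⟨Iio (t + 1), isOpen_Iio, by simp, fun x hx => ⟨hx.2, hx.1.le⟩⟩

theorem LocAC.aestronglyMeasurable {z : ℝ → E} (hz : LocAC z) :
    AEStronglyMeasurable z (volume.restrict (Ici (0 : ℝ))) :=
  hz.continuousOn.aestronglyMeasurable measurableSet_Ici

theorem clm_apply_eq_sum [NormedSpace ℝ E] [DecidableEq ι] (L : (ι → ℝ) →L[ℝ] E) (v : ι → ℝ) :
    L v = ∑ i, v i • L (Pi.single i 1) := by
  conv_lhs => rw [pi_eq_sum_univ' v]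
  simp [map_sum, map_smul]

theorem LocAC.contDiff_apply [NormedSpace ℝ E] [DecidableEq ι] {c : ℝ → (ι → ℝ) →L[ℝ] E}
    (hc : ContDiff ℝ 1 c)
    {w : ℝ → ι → ℝ} (hw : LocAC w) : LocAC fun t => c t (w t) := by
  simp only [fun t => clm_apply_eq_sum (c t) (w t)]
  exact LocAC.sum _ fun i _ => (hw.apply i).smul (ContDiff.locAC (hc.clm_apply contDiff_const))

theorem LocAC.eq_of_ae_hasDerivAt_zero [NormedSpace ℝ E] {z : ℝ → E} (hz : LocAC z)
    (h : ∀ᵐ t ∂(volume.restrict (Ici (0 : ℝ))), HasDerivAt z 0 t) {t : ℝ} (ht : 0 ≤ t) :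
    z t = z 0 := by
  rw [ae_restrict_iff' measurableSet_Ici] at h
  obtain ⟨C, hC⟩ := (hz t ht).const_of_ae_hasDerivAt_zero (by
    filter_upwards [h] with x hx hxt
    rw [uIcc_of_le ht] at hxt
    exact hx hxt.1)
  rw [hC t right_mem_uIcc, hC 0 left_mem_uIcc]

/-- The fundamental theorem of calculus for a real function whose derivative is known almost
everywhere. -/
theorem LocAC.integral_eq_sub {z φ : ℝ → ℝ} (hz : LocAC z)
    (h : ∀ᵐ t ∂(volume.restrict (Ici (0 : ℝ))), HasDerivAt z (φ t) t) {t : ℝ} (ht : 0 ≤ t) :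
    ∫ s in (0 : ℝ)..t, φ s = z t - z 0 := by
  rw [← (hz t ht).integral_deriv_eq_sub]
  rw [ae_restrict_iff' measurableSet_Ici] at h
  refine intervalIntegral.integral_congr_ae ?_
  filter_upwards [h] with x hx hxt
  rw [uIoc_of_le ht] at hxt
  exact (hx hxt.1.le).deriv.symm

theorem _root_.AbsolutelyContinuousOnInterval.congr_of_eqOn {z w : ℝ → E} {a b : ℝ}
    (hz : AbsolutelyContinuousOnInterval z a b) (h : EqOn z w (uIcc a b)) :
    AbsolutelyContinuousOnInterval w a b := by
  unfold AbsolutelyContinuousOnInterval at hz ⊢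
  refine hz.congr' ?_
  rw [EventuallyEq, eventually_inf_principal]
  refine Eventually.of_forall fun I hI => Finset.sum_congr rfl fun i hi => ?_
  rw [h (hI.1 i hi).1, h (hI.1 i hi).2]

theorem locAC_integral {g : ℝ → ι → ℝ} (hg : ∀ T, 0 ≤ T → IntervalIntegrable g volume 0 T) :
    LocAC fun t => ∫ s in (0 : ℝ)..t, g s := by
  refine locAC_pi fun i T hT => ?_
  have hgi : IntervalIntegrable (fun s => g s i) volume 0 T :=
    ⟨(ContinuousLinearMap.proj (R := ℝ) (φ := fun _ : ι => ℝ) i).integrable_comp (hg T hT).1,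
      (ContinuousLinearMap.proj (R := ℝ) (φ := fun _ : ι => ℝ) i).integrable_comp (hg T hT).2⟩
  have h := hgi.absolutelyContinuousOnInterval_intervalIntegral
    (c := 0) left_mem_uIcc
  refine h.congr_of_eqOn fun t ht => ?_
  rw [uIcc_of_le hT] at ht
  exact (ContinuousLinearMap.proj (R := ℝ) (φ := fun _ : ι => ℝ) i).intervalIntegral_comp_comm
    (hg t ht.1)

theorem ae_hasDerivAt_integral [NormedSpace ℝ E] [CompleteSpace E] {g : ℝ → E}
    (hg : ∀ T, 0 ≤ T → IntervalIntegrable g volume 0 T) :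
    ∀ᵐ t ∂(volume.restrict (Ici (0 : ℝ))),
      HasDerivAt (fun t => ∫ s in (0 : ℝ)..t, g s) (g t) t := by
  rw [ae_restrict_iff' measurableSet_Ici]
  have h := ae_all_iff.2 fun n : ℕ => (hg n n.cast_nonneg).ae_hasDerivAt_integral
  filter_upwards [h] with t ht ht0
  obtain ⟨n, hn⟩ := exists_nat_ge t
  exact ht n (by rw [uIcc_of_le n.cast_nonneg]; exact ⟨ht0, hn⟩) 0 left_mem_uIcc

end LocAC

/-! ### Exponentially decaying functions -/

/-- A function on `[0, ∞)` that is measurable and bounded by a decaying exponential. -/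
def ExpDecay {E : Type*} [NormedAddCommGroup E] (g : ℝ → E) : Prop :=
  AEStronglyMeasurable g (volume.restrict (Ici (0 : ℝ))) ∧
    ∃ a γ : ℝ, 0 < a ∧ 0 < γ ∧ ∀ t, 0 ≤ t → ‖g t‖ ≤ a * Real.exp (-γ * t)

section ExpDecay

variable {ι κ : Type*} [Fintype ι] [Fintype κ]
variable {E F : Type*} [NormedAddCommGroup E] [NormedAddCommGroup F]

theorem integrableOn_exp_neg_mul {γ : ℝ} (hγ : 0 < γ) (c : ℝ) :
    IntegrableOn (fun t => Real.exp (-γ * t)) (Ici c) :=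
  (integrableOn_Ici_iff_integrableOn_Ioi (by simp)).2 (exp_neg_integrableOn_Ioi c hγ)

theorem ExpDecay.integrableOn {g : ℝ → E} (hg : ExpDecay g) : IntegrableOn g (Ici 0) := by
  obtain ⟨hm, a, γ, ha, hγ, hb⟩ := hg
  refine Integrable.mono' ((integrableOn_exp_neg_mul hγ 0).const_mul a) hm ?_
  rw [ae_restrict_iff' measurableSet_Ici]
  exact Eventually.of_forall hb

theorem IntegrableOn.intervalIntegrable_zero {g : ℝ → E} (hg : IntegrableOn g (Ici 0)) (T : ℝ)
    (hT : 0 ≤ T) : IntervalIntegrable g volume 0 T := by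
  rw [intervalIntegrable_iff_integrableOn_Ioc_of_le hT]
  exact hg.mono_set fun t ht => ht.1.le

theorem ExpDecay.tendsto {g : ℝ → E} (hg : ExpDecay g) : Tendsto g atTop (𝓝 0) := by
  obtain ⟨-, a, γ, ha, hγ, hb⟩ := hg
  refine squeeze_zero_norm' (a := fun t => a * Real.exp (-γ * t)) ?_ ?_
  · filter_upwards [eventually_ge_atTop 0] with t ht using hb t ht
  · have h : Tendsto (fun t : ℝ => -γ * t) atTop atBot :=
      tendsto_id.const_mul_atTop_of_neg (by linarith)
    simpa using (Real.tendsto_exp_atBot.comp h).const_mul a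

/-- A function dominated by `|f|` and `|g|` linearly inherits their exponential decay. -/
theorem ExpDecay.of_le {f : ℝ → E} {g : ℝ → F} (hf : ExpDecay f) {C : ℝ}
    (hm : AEStronglyMeasurable g (volume.restrict (Ici (0 : ℝ))))
    (h : ∀ t, 0 ≤ t → ‖g t‖ ≤ C * ‖f t‖) : ExpDecay g := by
  obtain ⟨-, a, γ, ha, hγ, hb⟩ := hf
  refine ⟨hm, (|C| + 1) * a, γ, by positivity, hγ, fun t ht => (h t ht).trans ?_⟩
  rw [mul_assoc]
  refine mul_le_mul ?_ (hb t ht) (norm_nonneg _) (by positivity)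
  linarith [le_abs_self C]

theorem ExpDecay.add {f g : ℝ → E} (hf : ExpDecay f) (hg : ExpDecay g) :
    ExpDecay fun t => f t + g t := by
  obtain ⟨hm, a, γ, ha, hγ, hb⟩ := hf
  obtain ⟨hm', a', γ', ha', hγ', hb'⟩ := hg
  refine ⟨hm.add hm', a + a', min γ γ', by positivity, lt_min hγ hγ', fun t ht =>
    (norm_add_le _ _).trans ?_⟩
  rw [add_mul]
  refine add_le_add ((hb t ht).trans ?_) ((hb' t ht).trans ?_)
  · gcongr
    exact min_le_left _ _
  · gcongr
    exact min_le_right _ _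

theorem ExpDecay.neg {f : ℝ → E} (hf : ExpDecay f) : ExpDecay fun t => -f t :=
  hf.of_le (C := 1) hf.1.neg (by simp)

theorem ExpDecay.clm [NormedSpace ℝ E] [NormedSpace ℝ F] {f : ℝ → E} (hf : ExpDecay f)
    (L : E →L[ℝ] F) : ExpDecay fun t => L (f t) :=
  hf.of_le (C := ‖L‖) (L.continuous.comp_aestronglyMeasurable hf.1) fun _ _ => L.le_opNorm _

theorem ExpDecay.mulVec {f : ℝ → ι → ℝ} (hf : ExpDecay f) (N : Matrix κ ι ℝ) :
    ExpDecay fun t => N *ᵥ f t :=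
  hf.clm (LinearMap.toContinuousLinearMap N.mulVecLin)

theorem ExpDecay.bound {f : ℝ → E} (hf : ExpDecay f) : ∃ C, ∀ t, 0 ≤ t → ‖f t‖ ≤ C := by
  obtain ⟨-, a, γ, ha, hγ, hb⟩ := hf
  refine ⟨a, fun t ht => (hb t ht).trans ?_⟩
  have : Real.exp (-γ * t) ≤ 1 := Real.exp_le_one_iff.2 (by nlinarith)
  nlinarith

theorem ExpDecay.dotProduct {f g : ℝ → ι → ℝ} (hf : ExpDecay f) (hg : ExpDecay g) :
    ExpDecay fun t => f t ⬝ᵥ g t := by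
  obtain ⟨C, hC⟩ := hg.bound
  refine hf.of_le (C := Fintype.card ι * C) ?_ fun t ht => ?_
  · have hc : Continuous fun p : (ι → ℝ) × (ι → ℝ) => p.1 ⬝ᵥ p.2 := by fun_prop
    exact hc.comp_aestronglyMeasurable (hf.1.prodMk hg.1)
  · have hi : ∀ i, ‖f t i * g t i‖ ≤ C * ‖f t‖ := fun i => by
      rw [norm_mul, mul_comm]
      exact mul_le_mul ((norm_le_pi_norm _ i).trans (hC t ht)) (norm_le_pi_norm _ i)
        (norm_nonneg _) ((norm_nonneg _).trans (hC t ht))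
    refine (norm_sum_le_of_le _ fun i _ => hi i).trans ?_
    simp [mul_assoc]

theorem ExpDecay.memLp_two {f : ℝ → E} (hf : ExpDecay f) :
    MemLp f 2 (volume.restrict (Ici (0 : ℝ))) := by
  rw [memLp_two_iff_integrable_sq_norm hf.1]
  obtain ⟨C, hC⟩ := hf.bound
  have h : ExpDecay fun t => ‖f t‖ ^ 2 := hf.of_le (C := C) (hf.1.norm.pow 2) fun t ht => by
    rw [norm_pow, norm_norm, sq]
    exact mul_le_mul_of_nonneg_right (hC t ht) (norm_nonneg _)
  exact h.integrableOn

end ExpDecay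

/-! ### Linear differential equations with a forcing term -/

section LinearODE

variable {ι κ : Type*} [Fintype ι] [DecidableEq ι] [Fintype κ]

theorem LocAC.eq_flow {w : ℝ → ι → ℝ} {M : Matrix ι ι ℝ} (hw : LocAC w)
    (h : ∀ᵐ t ∂(volume.restrict (Ici (0 : ℝ))), HasDerivAt w (M *ᵥ w t) t) {t : ℝ}
    (ht : 0 ≤ t) : w t = flow M t (w 0) := by
  have hc : ContDiff ℝ 1 fun t => flow M (-t) := (contDiff_flow M).comp contDiff_neg
  have h1 := (hw.contDiff_apply hc).eq_of_ae_hasDerivAt_zero (by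
    filter_upwards [h] with s hs
    exact (((hasDerivAt_flow M (-s)).scomp s (hasDerivAt_neg s)).clm_apply hs).congr_deriv
      (by simp)) ht
  simp only [neg_zero, flow_zero, one_apply_eq_self] at h1
  rw [← h1, flow_apply_flow]
  simp

/-- Two solutions of the same forced equation differ by a solution of the homogeneous one. -/
theorem LocAC.sub_eq_flow {w w' : ℝ → ι → ℝ} {M : Matrix ι ι ℝ} {g : ℝ → ι → ℝ} (hw : LocAC w)
    (hw' : LocAC w')
    (h : ∀ᵐ t ∂(volume.restrict (Ici (0 : ℝ))), HasDerivAt w (M *ᵥ w t + g t) t)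
    (h' : ∀ᵐ t ∂(volume.restrict (Ici (0 : ℝ))), HasDerivAt w' (M *ᵥ w' t + g t) t) {t : ℝ}
    (ht : 0 ≤ t) : w t - w' t = flow M t (w 0 - w' 0) := by
  refine (hw.sub hw').eq_flow ?_ ht
  filter_upwards [h, h'] with s hs hs'
  refine (hs.sub hs').congr_deriv ?_
  rw [Matrix.mulVec_sub]
  abel

theorem intervalIntegrable_flow_apply (M : Matrix ι ι ℝ) {φ : ℝ → ℝ} (hφ : Continuous φ)
    {g : ℝ → ι → ℝ} {a b : ℝ} (hg : IntervalIntegrable g volume a b) :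
    IntervalIntegrable (fun s => flow M (φ s) (g s)) volume a b := by
  simp only [fun s => clm_apply_eq_sum (flow M (φ s)) (g s)]
  rw [← Finset.sum_fn]
  refine IntervalIntegrable.sum _ fun i _ => ?_
  have hgi : IntervalIntegrable (fun s => g s i) volume a b :=
    ⟨(ContinuousLinearMap.proj (R := ℝ) (φ := fun _ : ι => ℝ) i).integrable_comp hg.1,
      (ContinuousLinearMap.proj (R := ℝ) (φ := fun _ : ι => ℝ) i).integrable_comp hg.2⟩
  exact hgi.smul_continuousOn
    (((continuous_flow M).comp hφ).clm_apply continuous_const).continuousOn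

/-- The solution `x(t) = exp (tM) (x₀ + ∫₀ᵗ exp (-sM) g(s) ds)` of `x' = M x + g`,
`x(0) = x₀`. -/
def duhamel (M : Matrix ι ι ℝ) (g : ℝ → ι → ℝ) (x₀ : ι → ℝ) (t : ℝ) : ι → ℝ :=
  flow M t (x₀ + ∫ s in (0 : ℝ)..t, flow M (-s) (g s))

variable {M : Matrix ι ι ℝ} {g : ℝ → ι → ℝ} {x₀ : ι → ℝ}

theorem duhamel_zero : duhamel M g x₀ 0 = x₀ := by simp [duhamel]

theorem locAC_duhamel (hg : ∀ T, 0 ≤ T → IntervalIntegrable g volume 0 T) :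
    LocAC (duhamel M g x₀) :=
  ((locAC_const x₀).add (locAC_integral fun T hT =>
    intervalIntegrable_flow_apply M continuous_neg (hg T hT))).contDiff_apply (contDiff_flow M)

theorem hasDerivAt_duhamel (hg : ∀ T, 0 ≤ T → IntervalIntegrable g volume 0 T) :
    ∀ᵐ t ∂(volume.restrict (Ici (0 : ℝ))),
      HasDerivAt (duhamel M g x₀) (M *ᵥ duhamel M g x₀ t + g t) t := by
  filter_upwards [ae_hasDerivAt_integral fun T hT =>
    intervalIntegrable_flow_apply M continuous_neg (hg T hT)] with t ht
  refine ((hasDerivAt_flow M t).clm_apply (ht.const_add x₀)).congr_deriv ?_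
  simp [duhamel, flow_mulVec, flow_apply_flow]

theorem duhamel_eq (hg : ∀ T, 0 ≤ T → IntervalIntegrable g volume 0 T) {t : ℝ} (ht : 0 ≤ t) :
    duhamel M g x₀ t = flow M t x₀ + ∫ s in (0 : ℝ)..t, flow M (t - s) (g s) := by
  rw [duhamel, map_add, ← (flow M t).intervalIntegral_comp_comm
    (intervalIntegrable_flow_apply M continuous_neg (hg t ht))]
  simp [flow_apply_flow, sub_eq_add_neg]

theorem IsHurwitz.expDecay_flow (hM : IsHurwitz M) (v : ι → ℝ) : ExpDecay fun t => flow M t v := by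
  obtain ⟨C, α, hC, hα, hb⟩ := hM.flow_bound
  refine ⟨((continuous_flow M).clm_apply continuous_const).aestronglyMeasurable,
    C * (‖v‖ + 1), α, by positivity, hα, fun t ht => (hb t ht v).trans ?_⟩
  have := Real.exp_pos (-α * t)
  nlinarith [norm_nonneg v, mul_pos hC this]

/-- A stable linear system with exponentially decaying input has exponentially decaying state. -/
theorem IsHurwitz.expDecay_duhamel (hM : IsHurwitz M) (hg : ExpDecay g) (x₀ : ι → ℝ) :
    ExpDecay (duhamel M g x₀) := by
  have hgi := IntegrableOn.intervalIntegrable_zero hg.integrableOn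
  have hac : LocAC fun t => duhamel M g x₀ t - flow M t x₀ := (locAC_duhamel hgi).sub
    (ContDiff.locAC ((contDiff_flow M).clm_apply contDiff_const))
  obtain ⟨C, α, hC, hα, hb⟩ := hM.flow_bound
  suffices h : ExpDecay fun t => duhamel M g x₀ t - flow M t x₀ by
    have := h.add (hM.expDecay_flow x₀)
    simpa using this
  obtain ⟨-, a, γ, ha, hγ, hga⟩ := hg
  have hδ : 0 < min α γ := lt_min hα hγ
  set δ := min α γ with hδdef
  -- The convolution of two exponentials of rate `δ` is `t exp (-δt) ≤ (2/δ) exp (-δt/2)`.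
  refine ⟨hac.aestronglyMeasurable, C * a * (2 / δ), δ / 2, by positivity, by positivity,
    fun t ht => ?_⟩
  beta_reduce
  rw [duhamel_eq hgi ht, add_sub_cancel_left]
  have h1 : ∀ s ∈ uIoc 0 t, ‖flow M (t - s) (g s)‖ ≤ C * a * Real.exp (-δ * t) := by
    intro s hs
    rw [uIoc_of_le ht] at hs
    have hs1 := hb (t - s) (by linarith [hs.2]) (g s)
    have hs2 := hga s hs.1.le
    have e1 : Real.exp (-α * (t - s)) ≤ Real.exp (-δ * (t - s)) := Real.exp_le_exp.2
      (by nlinarith [min_le_left α γ, hs.2])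
    have e2 : Real.exp (-γ * s) ≤ Real.exp (-δ * s) := Real.exp_le_exp.2
      (by nlinarith [min_le_right α γ, hs.1])
    calc ‖flow M (t - s) (g s)‖ ≤ C * Real.exp (-δ * (t - s)) * (a * Real.exp (-δ * s)) := by
          refine hs1.trans ?_
          gcongr
          exact hs2.trans (by gcongr)
      _ = C * a * (Real.exp (-δ * (t - s)) * Real.exp (-δ * s)) := by ring
      _ = C * a * Real.exp (-δ * t) := by rw [← Real.exp_add]; ring_nf
  refine (intervalIntegral.norm_integral_le_of_norm_le_const h1).trans ?_
  rw [sub_zero, abs_of_nonneg ht]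
  have h2 : δ / 2 * t ≤ Real.exp (δ / 2 * t) := (Real.add_one_le_exp _).trans' (by linarith)
  have h3 : Real.exp (-δ * t) = Real.exp (-(δ / 2) * t) * Real.exp (-(δ / 2) * t) := by
    rw [← Real.exp_add]; ring_nf
  have h4 : t * Real.exp (-(δ / 2) * t) ≤ 2 / δ := by
    rw [neg_mul, Real.exp_neg, ← div_eq_mul_inv, div_le_div_iff₀ (Real.exp_pos _) hδ]
    linarith
  rw [h3]
  have := mul_le_mul_of_nonneg_left h4 (mul_pos (mul_pos hC ha) (Real.exp_pos (-(δ / 2) * t))).le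
  linarith

/-- A linear system whose reversal in time is stable has, for an exponentially decaying input, a
solution that decays at infinity. -/
theorem IsHurwitz.exists_expDecay_terminal (hM : IsHurwitz M) (hg : ExpDecay g) :
    ∃ h : ℝ → ι → ℝ, LocAC h ∧ (∀ᵐ t ∂(volume.restrict (Ici (0 : ℝ))),
      HasDerivAt h (-(M *ᵥ h t) - g t) t) ∧ ExpDecay h := by
  have hgi := IntegrableOn.intervalIntegrable_zero hg.neg.integrableOn
  obtain ⟨C, α, hC, hα, hb⟩ := hM.flow_bound
  have hm : AEStronglyMeasurable (fun s => flow M s (g s)) (volume.restrict (Ici (0 : ℝ))) := by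
    simp only [fun s => clm_apply_eq_sum (flow M s) (g s)]
    refine Finset.aestronglyMeasurable_fun_sum _ fun i _ => ?_
    exact AEStronglyMeasurable.smul
      ((ContinuousLinearMap.proj (R := ℝ)
        (φ := fun _ : ι => ℝ) i).continuous.comp_aestronglyMeasurable hg.1) ((continuous_flow M).clm_apply continuous_const).aestronglyMeasurable
  have hle : ∀ s, 0 ≤ s → ∀ v, ‖flow M s v‖ ≤ C * ‖v‖ := fun s hs v => (hb s hs v).trans (by
    have : Real.exp (-α * s) ≤ 1 := Real.exp_le_one_iff.2 (by nlinarith)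
    gcongr
    nlinarith)
  have hint : ExpDecay fun s => flow M s (g s) := hg.of_le hm fun s hs => hle s hs _
  refine ⟨duhamel (-M) (fun t => -g t) (∫ s in Ioi 0, flow M s (g s)), locAC_duhamel hgi, ?_, ?_⟩
  · filter_upwards [hasDerivAt_duhamel (M := -M)
      (x₀ := ∫ s in Ioi 0, flow M s (g s)) hgi] with t ht
    simpa [Matrix.neg_mulVec, sub_eq_add_neg] using ht
  obtain ⟨hgm, a, γ, ha, hγ, hga⟩ := hg
  refine ⟨(locAC_duhamel hgi).aestronglyMeasurable, C * (a / γ), γ, by positivity, hγ,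
    fun t ht => ?_⟩
  have hio : IntegrableOn (fun s => flow M s (g s)) (Ioi 0) :=
    hint.integrableOn.mono_set Ioi_subset_Ici_self
  have e1 : duhamel (-M) (fun t => -g t) (∫ s in Ioi 0, flow M s (g s)) t =
      ∫ s in Ioi t, flow M (s - t) (g s) := by
    have e2 : ∫ s in Ioi t, flow M (s - t) (g s) = flow M (-t) (∫ s in Ioi t, flow M s (g s)) := by
      rw [← ContinuousLinearMap.integral_comp_comm _ (hio.mono_set (Ioi_subset_Ioi ht))]
      simp only [flow_apply_flow, sub_eq_neg_add]
    rw [e2, duhamel, flow_neg]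
    congr 1
    simp only [flow_neg, neg_neg, map_neg, intervalIntegral.integral_neg]
    rw [← intervalIntegral.integral_Ioi_sub_Ioi hio ht]
    abel
  rw [e1]
  refine (norm_integral_le_of_norm_le ((integrableOn_exp_neg_mul hγ t).mono_set
    Ioi_subset_Ici_self |>.const_mul (C * a)) ?_).trans ?_
  · rw [ae_restrict_iff' measurableSet_Ioi]
    refine Eventually.of_forall fun s hs => (hle (s - t) (sub_nonneg.2 (le_of_lt hs)) _).trans ?_
    rw [mul_assoc]
    gcongr
    exact hga s (ht.trans (le_of_lt hs))
  · rw [integral_const_mul, integral_exp_mul_Ioi (by linarith)]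
    exact le_of_eq (by field_simp)

end LinearODE

/-! ### Quadratic forms -/

section QuadraticForm

variable {ι κ : Type*} [Fintype ι] [Fintype κ]

theorem posSemidef_iff_real {P : Matrix ι ι ℝ} :
    P.PosSemidef ↔ Pᵀ = P ∧ ∀ x, 0 ≤ x ⬝ᵥ P *ᵥ x := by
  rw [Matrix.posSemidef_iff_dotProduct_mulVec, Matrix.IsHermitian,
    Matrix.conjTranspose_eq_transpose_of_trivial]
  simp

theorem dotProduct_transpose_mulVec (M : Matrix ι κ ℝ) (x : κ → ℝ) (y : ι → ℝ) :
    x ⬝ᵥ Mᵀ *ᵥ y = (M *ᵥ x) ⬝ᵥ y := by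
  rw [Matrix.dotProduct_mulVec, Matrix.vecMul_transpose]

theorem dotProduct_transpose_mul_mulVec (M : Matrix κ ι ℝ) (N : Matrix κ κ ℝ) (x y : ι → ℝ) :
    x ⬝ᵥ (Mᵀ * N * M) *ᵥ y = (M *ᵥ x) ⬝ᵥ N *ᵥ (M *ᵥ y) := by
  rw [← Matrix.mulVec_mulVec, ← Matrix.mulVec_mulVec, dotProduct_transpose_mulVec]

theorem dotProduct_mulVec_comm {P : Matrix ι ι ℝ} (hP : Pᵀ = P) (x y : ι → ℝ) :
    x ⬝ᵥ P *ᵥ y = y ⬝ᵥ P *ᵥ x := by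
  rw [dotProduct_comm, ← dotProduct_transpose_mulVec, hP]

theorem eq_zero_of_dotProduct_mulVec {X : Matrix ι κ ℝ} (h : ∀ u v, u ⬝ᵥ X *ᵥ v = 0) :
    X = 0 := by
  classical
  ext i j
  simpa using h (Pi.single i 1) (Pi.single j 1)

theorem posSemidef_transpose_mul_mul {Θ : Matrix κ κ ℝ} (hΘ : Θ.PosSemidef) (K : Matrix κ ι ℝ) :
    (Kᵀ * Θ * K).PosSemidef := by
  rw [← Matrix.conjTranspose_eq_transpose_of_trivial]
  exact hΘ.conjTranspose_mul_mul_same K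

theorem posDef_eq_zero {Θ : Matrix κ κ ℝ} (hΘ : Θ.PosDef) {x : κ → ℝ} (h : x ⬝ᵥ Θ *ᵥ x = 0) :
    x = 0 := by
  by_contra hx
  have := hΘ.dotProduct_mulVec_pos hx
  rw [star_trivial] at this
  exact this.ne' h

theorem _root_.HasDerivAt.matrix_mulVec {u : ℝ → ι → ℝ} {u' : ι → ℝ} {t : ℝ}
    (hu : HasDerivAt u u' t) (M : Matrix κ ι ℝ) :
    HasDerivAt (fun s => M *ᵥ u s) (M *ᵥ u') t :=
  (LinearMap.toContinuousLinearMap M.mulVecLin).hasFDerivAt.comp_hasDerivAt t hu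

theorem _root_.HasDerivAt.dotProduct {u v : ℝ → ι → ℝ} {u' v' : ι → ℝ} {t : ℝ}
    (hu : HasDerivAt u u' t) (hv : HasDerivAt v v' t) :
    HasDerivAt (fun s => u s ⬝ᵥ v s) (u' ⬝ᵥ v t + u t ⬝ᵥ v') t := by
  rw [hasDerivAt_pi] at hu hv
  refine (HasDerivAt.fun_sum fun i _ => (hu i).mul (hv i)).congr_deriv ?_
  simp [_root_.dotProduct, Finset.sum_add_distrib]

theorem isClosed_posSemidef : IsClosed {P : Matrix ι ι ℝ | P.PosSemidef} := by
  simp only [posSemidef_iff_real, ofPred_and, ofPred_forall]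
  refine (isClosed_eq (by fun_prop) continuous_id).inter (isClosed_iInter fun x => ?_)
  exact isClosed_le continuous_const (by fun_prop)

end QuadraticForm

/-! ### Lyapunov equations -/

section Lyapunov

variable {ι ι' κ l : Type*} [Fintype ι] [DecidableEq ι] [Fintype ι'] [DecidableEq ι'] [Fintype κ]
  [Fintype l]

/-- The Sylvester equation `MᵀX + XN = 0` with Hurwitz `M`, `N` has only the trivial solution:
`uᵀ exp (tMᵀ) X exp (tN) v` is constant in `t` and tends to zero. -/
theorem IsHurwitz.sylvester_eq_zero {M : Matrix ι ι ℝ} {N : Matrix ι' ι' ℝ} (hM : IsHurwitz M)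
    (hN : IsHurwitz N) {X : Matrix ι ι' ℝ} (h : Mᵀ * X + X * N = 0) : X = 0 := by
  refine eq_zero_of_dotProduct_mulVec fun u v => ?_
  let φ : ℝ → ℝ := fun t => flow M t u ⬝ᵥ X *ᵥ flow N t v
  have hφ : ∀ t, HasDerivAt φ 0 t := fun t => by
    refine ((hasDerivAt_flow_apply M t u).dotProduct
      ((hasDerivAt_flow_apply N t v).matrix_mulVec X)).congr_deriv ?_
    rw [← dotProduct_transpose_mulVec, ← dotProduct_add, Matrix.mulVec_mulVec,
      Matrix.mulVec_mulVec, ← Matrix.add_mulVec, h, Matrix.zero_mulVec, dotProduct_zero]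
  have hlim : Tendsto φ atTop (𝓝 0) :=
    ((hM.expDecay_flow u).dotProduct ((hN.expDecay_flow v).mulVec X)).tendsto
  have hc : ∀ t, φ t = φ 0 := fun t =>
    is_const_of_deriv_eq_zero (fun t => (hφ t).differentiableAt) (fun t => (hφ t).deriv) t 0
  have h0 : φ 0 = 0 := tendsto_nhds_unique (tendsto_const_nhds.congr fun t => (hc t).symm) hlim
  simpa [φ] using h0

theorem IsHurwitz.posSemidef_of_lyapunov {M X W : Matrix ι ι ℝ} (hM : IsHurwitz M) (hX : Xᵀ = X)
    (hW : W.PosSemidef) (h : Mᵀ * X + X * M + W = 0) : X.PosSemidef := by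
  refine posSemidef_iff_real.2 ⟨hX, fun x => ?_⟩
  let φ : ℝ → ℝ := fun t => flow M t x ⬝ᵥ X *ᵥ flow M t x
  have hφ : ∀ t, HasDerivAt φ (-(flow M t x ⬝ᵥ W *ᵥ flow M t x)) t := fun t => by
    refine ((hasDerivAt_flow_apply M t x).dotProduct
      ((hasDerivAt_flow_apply M t x).matrix_mulVec X)).congr_deriv ?_
    rw [← dotProduct_transpose_mulVec, ← dotProduct_add, Matrix.mulVec_mulVec,
      Matrix.mulVec_mulVec, ← Matrix.add_mulVec, eq_neg_of_add_eq_zero_left h, Matrix.neg_mulVec,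
      dotProduct_neg]
  have hanti : Antitone φ := antitone_of_hasDerivAt_nonpos hφ fun t =>
    neg_nonpos.2 ((posSemidef_iff_real.1 hW).2 _)
  have hlim : Tendsto φ atTop (𝓝 0) :=
    ((hM.expDecay_flow x).dotProduct ((hM.expDecay_flow x).mulVec X)).tendsto
  simpa [φ] using hanti.le_of_tendsto hlim 0

/-- The Lyapunov equation of a Hurwitz matrix is solvable, since the Lyapunov operator is an
injective endomorphism of a finite-dimensional space. -/
theorem IsHurwitz.exists_lyapunov {M W : Matrix ι ι ℝ} (hM : IsHurwitz M) (hW : W.PosSemidef) :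
    ∃ X : Matrix ι ι ℝ, X.PosSemidef ∧ Mᵀ * X + X * M + W = 0 := by
  let Λ : Matrix ι ι ℝ →ₗ[ℝ] Matrix ι ι ℝ :=
    LinearMap.mulLeft ℝ Mᵀ + LinearMap.mulRight ℝ M
  have hΛ : ∀ X, Λ X = Mᵀ * X + X * M := fun X => rfl
  have hinj : Function.Injective Λ := (injective_iff_map_eq_zero Λ).2 fun X hX =>
    hM.sylvester_eq_zero hM hX
  obtain ⟨X, hX⟩ := LinearMap.injective_iff_surjective.1 hinj (-W)
  have hX' : Mᵀ * X + X * M + W = 0 := by rw [← hΛ, hX, neg_add_cancel]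
  have hsymm : Xᵀ = X := hinj (by
    rw [hX, hΛ, ← (posSemidef_iff_real.1 hW).1, ← Matrix.transpose_neg, ← hX, hΛ]
    simp [Matrix.transpose_mul, add_comm])
  exact ⟨X, hM.posSemidef_of_lyapunov hsymm hW hX', hX'⟩

/-- A Lyapunov inequality with a detectable right-hand side forces stability: an eigenvector for
an eigenvalue in the closed right half-plane would be annihilated by `F` and `K`, hence be an
eigenvector of `A + N F`. -/
theorem isHurwitz_of_lyapunov {A P W : Matrix ι ι ℝ} {B : Matrix ι κ ℝ} {K : Matrix κ ι ℝ}
    {Θ : Matrix κ κ ℝ} {F : Matrix l ι ℝ} {N : Matrix ι l ℝ} (hP : P.PosSemidef) (hΘ : Θ.PosDef)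
    (hW : W.PosSemidef) (hN : IsHurwitz (A + N * F))
    (h : (A + B * K)ᵀ * P + P * (A + B * K) + (Fᵀ * F + Kᵀ * Θ * K) + W = 0) :
    IsHurwitz (A + B * K) := by
  set M := A + B * K with hM
  have hq : ∀ x, (M *ᵥ x) ⬝ᵥ P *ᵥ x + x ⬝ᵥ P *ᵥ (M *ᵥ x) + ((F *ᵥ x) ⬝ᵥ (F *ᵥ x) +
      (K *ᵥ x) ⬝ᵥ Θ *ᵥ (K *ᵥ x)) + x ⬝ᵥ W *ᵥ x = 0 := by
    intro x
    have := congrArg (fun Y : Matrix ι ι ℝ => x ⬝ᵥ Y *ᵥ x) h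
    simp only [Matrix.add_mulVec, dotProduct_add, Matrix.zero_mulVec, dotProduct_zero,
      dotProduct_transpose_mul_mulVec] at this
    simpa only [← Matrix.mulVec_mulVec, dotProduct_transpose_mulVec] using this
  rw [isHurwitz_iff] at hN ⊢
  intro σ ω a b hσ ha hb
  have hPn := (posSemidef_iff_real.1 hP).2
  have hWn := (posSemidef_iff_real.1 hW).2
  have hΘn := (posSemidef_iff_real.1 hΘ.posSemidef).2
  have hFn : ∀ x : l → ℝ, 0 ≤ x ⬝ᵥ x := fun x => Finset.sum_nonneg fun i _ => mul_self_nonneg _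
  have ha' := hq a
  have hb' := hq b
  rw [ha] at ha'
  rw [hb] at hb'
  simp only [Matrix.mulVec_add, Matrix.mulVec_sub, Matrix.mulVec_smul, add_dotProduct,
    sub_dotProduct, dotProduct_add, dotProduct_sub, smul_dotProduct, dotProduct_smul,
    smul_eq_mul] at ha' hb'
  have h1 := mul_nonneg hσ (hPn a)
  have h2 := mul_nonneg hσ (hPn b)
  have h3 := hWn a
  have h4 := hWn b
  have h5 := hΘn (K *ᵥ a)
  have h6 := hΘn (K *ᵥ b)
  have h7 := hFn (F *ᵥ a)
  have h8 := hFn (F *ᵥ b)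
  have Ka : K *ᵥ a = 0 := posDef_eq_zero hΘ (by linarith)
  have Kb : K *ᵥ b = 0 := posDef_eq_zero hΘ (by linarith)
  have Fa : F *ᵥ a = 0 := dotProduct_self_eq_zero.1 (by linarith)
  have Fb : F *ᵥ b = 0 := dotProduct_self_eq_zero.1 (by linarith)
  refine hN σ ω a b hσ ?_ ?_
  · rw [← ha, hM]
    simp [Matrix.add_mulVec, ← Matrix.mulVec_mulVec, Ka, Fa]
  · rw [← hb, hM]
    simp [Matrix.add_mulVec, ← Matrix.mulVec_mulVec, Kb, Fb]

end Lyapunov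

/-! ### The algebraic Riccati equation -/

section Riccati

variable {ι κ l : Type*} [Fintype ι] [Fintype κ] [DecidableEq κ] [Fintype l]

/-- The Riccati operator `P ↦ PA + AᵀP - P B Θ⁻¹ Bᵀ P + Q`. -/
def riccati (A : Matrix ι ι ℝ) (B : Matrix ι κ ℝ) (Q : Matrix ι ι ℝ) (Θ : Matrix κ κ ℝ)
    (P : Matrix ι ι ℝ) : Matrix ι ι ℝ :=
  P * A + Aᵀ * P - P * (B * Θ⁻¹ * Bᵀ) * P + Q

/-- The gain `-Θ⁻¹ Bᵀ P` of the feedback associated with `P`. -/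
def gain (B : Matrix ι κ ℝ) (Θ : Matrix κ κ ℝ) (P : Matrix ι ι ℝ) : Matrix κ ι ℝ :=
  -(Θ⁻¹ * Bᵀ * P)

variable {A Q : Matrix ι ι ℝ} {B : Matrix ι κ ℝ} {Θ : Matrix κ κ ℝ}

theorem add_mul_gain (P : Matrix ι ι ℝ) : A + B * gain B Θ P = A - B * Θ⁻¹ * Bᵀ * P := by
  simp only [gain, Matrix.mul_neg, Matrix.mul_assoc, sub_eq_add_neg]

/-- Completion of the square in the Lyapunov operator of a feedback `K`. -/
theorem lyapunov_eq_riccati_add (hΘ : Θ.PosDef) {P : Matrix ι ι ℝ} (hP : Pᵀ = P)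
    (K : Matrix κ ι ℝ) :
    (A + B * K)ᵀ * P + P * (A + B * K) + (Q + Kᵀ * Θ * K) =
      riccati A B Q Θ P + (K - gain B Θ P)ᵀ * Θ * (K - gain B Θ P) := by
  have hu : IsUnit Θ.det := (Matrix.isUnit_iff_isUnit_det Θ).1 hΘ.isUnit
  have hs : Θᵀ = Θ := (posSemidef_iff_real.1 hΘ.posSemidef).1
  have h1 : ∀ X : Matrix κ ι ℝ, Θ * (Θ⁻¹ * X) = X := fun X =>
    Matrix.mul_nonsing_inv_cancel_left Θ X hu
  have h2 : ∀ X : Matrix κ ι ℝ, Θ⁻¹ * (Θ * X) = X := fun X =>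
    Matrix.nonsing_inv_mul_cancel_left Θ X hu
  simp only [riccati, gain, sub_neg_eq_add, Matrix.transpose_add, Matrix.transpose_mul,
    Matrix.transpose_transpose, Matrix.transpose_nonsing_inv, hP, hs, Matrix.mul_add,
    Matrix.add_mul, Matrix.mul_assoc, h1, h2]
  abel

/-- The Lyapunov equation of a stabilizing feedback produces a subsolution of the Riccati
equation. -/
theorem posSemidef_neg_riccati (hΘ : Θ.PosDef) {P : Matrix ι ι ℝ} (hP : Pᵀ = P)
    {K : Matrix κ ι ℝ} (h : (A + B * K)ᵀ * P + P * (A + B * K) + (Q + Kᵀ * Θ * K) = 0) :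
    (-riccati A B Q Θ P).PosSemidef := by
  rw [lyapunov_eq_riccati_add hΘ hP] at h
  rw [neg_eq_of_add_eq_zero_right h]
  exact posSemidef_transpose_mul_mul hΘ.posSemidef _

variable [DecidableEq ι]

theorem isHurwitz_of_riccati {F : Matrix l ι ℝ} (hΘ : Θ.PosDef) (hF : IsDetectable A F)
    {P : Matrix ι ι ℝ} (hP : P.PosSemidef)
    (h : (-riccati A B (Fᵀ * F) Θ P).PosSemidef) : IsHurwitz (A + B * gain B Θ P) := by
  obtain ⟨N, hN⟩ := hF
  refine isHurwitz_of_lyapunov hP hΘ h hN ?_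
  rw [lyapunov_eq_riccati_add hΘ (posSemidef_iff_real.1 hP).1]
  simp

theorem riccati_unique {F : Matrix l ι ℝ} (hΘ : Θ.PosDef) (hF : IsDetectable A F)
    {P P' : Matrix ι ι ℝ} (hP : P.PosSemidef) (hP' : P'.PosSemidef)
    (h : riccati A B (Fᵀ * F) Θ P = 0) (h' : riccati A B (Fᵀ * F) Θ P' = 0) : P = P' := by
  have hH := isHurwitz_of_riccati hΘ hF hP (by rw [h, neg_zero]; exact Matrix.PosSemidef.zero)
  have hH' := isHurwitz_of_riccati hΘ hF hP' (by rw [h', neg_zero]; exact Matrix.PosSemidef.zero)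
  have hs : Θᵀ = Θ := (posSemidef_iff_real.1 hΘ.posSemidef).1
  have e := h.trans h'.symm
  refine sub_eq_zero.1 (hH.sylvester_eq_zero hH' ?_)
  have e' := sub_eq_zero.2 e
  rw [← e']
  simp only [riccati, add_mul_gain, Matrix.transpose_sub, Matrix.transpose_mul,
    Matrix.transpose_transpose, Matrix.transpose_nonsing_inv, (posSemidef_iff_real.1 hP).1, hs,
    Matrix.mul_sub, Matrix.sub_mul, Matrix.mul_assoc]
  abel

theorem abs_apply_le_trace {P : Matrix ι ι ℝ} (hP : P.PosSemidef) (i j : ι) :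
    |P i j| ≤ P.trace := by
  obtain ⟨hs, hn⟩ := posSemidef_iff_real.1 hP
  have hsij : P j i = P i j := congrFun (congrFun hs i) j
  have hd : ∀ k, P k k ≤ P.trace := fun k =>
    Finset.single_le_sum (f := fun k => P k k) (fun k _ => hP.diag_nonneg) (Finset.mem_univ k)
  have h1 := hn (Pi.single i 1 + Pi.single j 1)
  have h2 := hn (Pi.single i 1 - Pi.single j 1)
  simp only [Matrix.mulVec_add, Matrix.mulVec_sub, add_dotProduct, sub_dotProduct, dotProduct_add,
    dotProduct_sub, Matrix.mulVec_single_one, single_one_dotProduct, Matrix.col_apply,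
    hsij] at h1 h2
  have := hd i
  have := hd j
  rw [abs_le]
  constructor <;> linarith

/-- Existence of a positive semi-definite solution of the Riccati equation. Among the positive
semi-definite subsolutions, one of minimal trace exists by compactness; a Newton step yields
another subsolution that lies below it, so that it is a solution. -/
theorem exists_riccati_eq_zero [DecidableEq l] {F : Matrix l ι ℝ} (hΘ : Θ.PosDef)
    (hB : IsStabilizable A B) (hF : IsDetectable A F) :
    ∃ P : Matrix ι ι ℝ, P.PosSemidef ∧ riccati A B (Fᵀ * F) Θ P = 0 := by
  have hFF : (Fᵀ * F).PosSemidef := by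
    simpa using posSemidef_transpose_mul_mul (Matrix.PosSemidef.one (n := l) (R := ℝ)) F
  have hlyap : ∀ K : Matrix κ ι ℝ, IsHurwitz (A + B * K) → ∃ P : Matrix ι ι ℝ, P.PosSemidef ∧
      (A + B * K)ᵀ * P + P * (A + B * K) + (Fᵀ * F + Kᵀ * Θ * K) = 0 := fun K hK =>
    hK.exists_lyapunov (hFF.add (posSemidef_transpose_mul_mul hΘ.posSemidef K))
  obtain ⟨K₀, hK₀⟩ := hB
  obtain ⟨P₀, hP₀, h₀⟩ := hlyap K₀ hK₀
  let S : Set (Matrix ι ι ℝ) := {P | P.PosSemidef} ∩ ({P | (-riccati A B (Fᵀ * F) Θ P).PosSemidef} ∩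
    {P | P.trace ≤ P₀.trace})
  have hS₀ : P₀ ∈ S := ⟨hP₀, posSemidef_neg_riccati hΘ (posSemidef_iff_real.1 hP₀).1 h₀,
    show P₀.trace ≤ P₀.trace from le_rfl⟩
  have hcr : Continuous (riccati A B (Fᵀ * F) Θ) := by unfold riccati; fun_prop
  have htr : Continuous fun P : Matrix ι ι ℝ => P.trace := by fun_prop
  have hSc : IsCompact S := by
    have hbox : IsCompact (Set.pi univ fun _ : ι => Set.pi univ fun _ : ι =>
        Icc (-P₀.trace) P₀.trace) :=
      isCompact_univ_pi fun _ => isCompact_univ_pi fun _ => isCompact_Icc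
    refine hbox.of_isClosed_subset (isClosed_posSemidef.inter
      ((isClosed_posSemidef.preimage hcr.neg).inter (isClosed_le htr continuous_const))) ?_
    rintro P ⟨h1, -, h3⟩ i - j -
    exact abs_le.1 ((abs_apply_le_trace h1 i j).trans h3)
  obtain ⟨P, ⟨hP, hR, hPt⟩, hmin⟩ := hSc.exists_isMinOn ⟨P₀, hS₀⟩ htr.continuousOn
  refine ⟨P, hP, ?_⟩
  have hPs := (posSemidef_iff_real.1 hP).1
  have hK := isHurwitz_of_riccati hΘ hF hP hR
  obtain ⟨P', hP', h'⟩ := hlyap _ hK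
  have hlP := lyapunov_eq_riccati_add (A := A) (B := B) (Q := Fᵀ * F) hΘ hPs (gain B Θ P)
  rw [sub_self, Matrix.mul_zero, add_zero] at hlP
  have hdiff : (A + B * gain B Θ P)ᵀ * (P - P') + (P - P') * (A + B * gain B Θ P) +
      -riccati A B (Fᵀ * F) Θ P = 0 := by
    rw [← hlP]
    simp only [Matrix.mul_sub, Matrix.sub_mul]
    rw [← sub_eq_zero.2 h'.symm]
    abel
  have hX : (P - P').PosSemidef := hK.posSemidef_of_lyapunov
    (by rw [Matrix.transpose_sub, hPs, (posSemidef_iff_real.1 hP').1]) hR hdiff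
  have hXt := hX.trace_nonneg
  rw [Matrix.trace_sub] at hXt
  have hS' : P' ∈ S := ⟨hP', posSemidef_neg_riccati hΘ (posSemidef_iff_real.1 hP').1 h',
    show P'.trace ≤ P₀.trace by have : P.trace ≤ P₀.trace := hPt; linarith⟩
  have hle : P.trace ≤ P'.trace := hmin hS'
  have hX0 : P - P' = 0 := hX.trace_eq_zero_iff.1 (by rw [Matrix.trace_sub]; linarith)
  rw [hX0] at hdiff
  simpa using hdiff

end Riccati

/-! ### Terminal-value problems -/

section Terminal

variable {ι : Type*} [Fintype ι] [DecidableEq ι]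

theorem IsHurwitz.terminal_unique {M : Matrix ι ι ℝ} (hM : IsHurwitz M) {g h h' : ℝ → ι → ℝ}
    (hac : LocAC h) (hac' : LocAC h')
    (hd : ∀ᵐ t ∂(volume.restrict (Ici (0 : ℝ))), HasDerivAt h (-(M *ᵥ h t) - g t) t)
    (hd' : ∀ᵐ t ∂(volume.restrict (Ici (0 : ℝ))), HasDerivAt h' (-(M *ᵥ h' t) - g t) t)
    (hl : Tendsto h atTop (𝓝 0)) (hl' : Tendsto h' atTop (𝓝 0)) : EqOn h' h (Ici 0) := by
  have key : ∀ t, 0 ≤ t → h' t - h t = flow (-M) t (h' 0 - h 0) := fun t ht => by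
    refine hac'.sub_eq_flow (g := fun t => -g t) hac ?_ ?_ ht
    · filter_upwards [hd'] with t ht
      simpa [Matrix.neg_mulVec, sub_eq_add_neg] using ht
    · filter_upwards [hd] with t ht
      simpa [Matrix.neg_mulVec, sub_eq_add_neg] using ht
  -- Transporting the difference back to time `0` is a bounded operation, uniformly in time.
  obtain ⟨C, α, hC, hα, hb⟩ := hM.flow_bound
  have hle : ∀ t, 0 ≤ t → ‖h' 0 - h 0‖ ≤ C * ‖h' t - h t‖ := fun t ht => by
    have e : flow M t (h' t - h t) = h' 0 - h 0 := by
      rw [key t ht, flow_neg, flow_apply_flow]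
      simp
    rw [← e]
    refine (hb t ht _).trans ?_
    have : Real.exp (-α * t) ≤ 1 := Real.exp_le_one_iff.2 (by nlinarith)
    gcongr
    nlinarith
  have hlim : Tendsto (fun t => C * ‖h' t - h t‖) atTop (𝓝 0) := by
    simpa using ((hl'.sub hl).norm.const_mul C)
  have h0 : h' 0 - h 0 = 0 := norm_le_zero_iff.1
    (ge_of_tendsto hlim ((eventually_ge_atTop 0).mono hle))
  intro t ht
  have := key t ht
  rw [h0, map_zero] at this
  exact sub_eq_zero.1 this

theorem ExpDecay.exists_primitive {φ : ℝ → ℝ} (hφ : ExpDecay φ) :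
    ∃ s : ℝ → ℝ, LocAC s ∧ (∀ᵐ t ∂(volume.restrict (Ici (0 : ℝ))), HasDerivAt s (φ t) t) ∧
      Tendsto s atTop (𝓝 0) := by
  have hi := IntegrableOn.intervalIntegrable_zero hφ.integrableOn
  refine ⟨fun t => (∫ r in (0 : ℝ)..t, φ r) - ∫ r in Ioi 0, φ r, LocAC.sub (fun T hT =>
    (hi T hT).absolutelyContinuousOnInterval_intervalIntegral left_mem_uIcc) (locAC_const _),
    ?_, ?_⟩
  · filter_upwards [ae_hasDerivAt_integral hi] with t ht using ht.sub_const _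
  · simpa using (intervalIntegral_tendsto_integral_Ioi 0
      (hφ.integrableOn.mono_set Ioi_subset_Ici_self) tendsto_id).sub_const (∫ r in Ioi 0, φ r)

theorem LocAC.primitive_unique {s s' φ : ℝ → ℝ} (hac : LocAC s) (hac' : LocAC s')
    (hd : ∀ᵐ t ∂(volume.restrict (Ici (0 : ℝ))), HasDerivAt s (φ t) t)
    (hd' : ∀ᵐ t ∂(volume.restrict (Ici (0 : ℝ))), HasDerivAt s' (φ t) t)
    (hl : Tendsto s atTop (𝓝 0)) (hl' : Tendsto s' atTop (𝓝 0)) : EqOn s' s (Ici 0) := by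
  have key : ∀ t, 0 ≤ t → s' t - s t = s' 0 - s 0 := fun t ht => by
    refine (hac'.sub hac).eq_of_ae_hasDerivAt_zero ?_ ht
    filter_upwards [hd, hd'] with t h1 h2
    exact (h2.sub h1).congr_deriv (sub_self _)
  have h0 : s' 0 - s 0 = 0 := by
    refine tendsto_nhds_unique (tendsto_const_nhds.congr' ?_) (by simpa using hl'.sub hl)
    filter_upwards [eventually_ge_atTop 0] with t ht using (key t ht).symm
  intro t ht
  exact sub_eq_zero.1 ((key t ht).trans h0)

end Terminal

/-! ### The value of a regular problem -/

section Value

variable {ι κ : Type*} [Fintype ι] [Fintype κ]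

theorem _root_.MeasureTheory.MemLp.matrix_mulVec {v : ℝ → ι → ℝ} {μ : Measure ℝ}
    (hv : MemLp v 2 μ) (M : Matrix κ ι ℝ) : MemLp (fun t => M *ᵥ v t) 2 μ :=
  (LinearMap.toContinuousLinearMap M.mulVecLin).comp_memLp' hv

theorem _root_.MeasureTheory.MemLp.integrable_dotProduct {v w : ℝ → ι → ℝ} {μ : Measure ℝ}
    (hv : MemLp v 2 μ) (hw : MemLp w 2 μ) : Integrable (fun t => v t ⬝ᵥ w t) μ :=
  integrable_finsetSum _ fun i _ => (hv.eval i).integrable_mul (hw.eval i)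

variable [DecidableEq κ]

/-- The candidate optimal control `-Θ⁻¹ Bᵀ (P x + h(t))`. -/
def optimalControl (B : Matrix ι κ ℝ) (Θ : Matrix κ κ ℝ) (P : Matrix ι ι ℝ) (h : ℝ → ι → ℝ)
    (x : ι → ℝ) (t : ℝ) : κ → ℝ :=
  gain B Θ P *ᵥ x + -(Θ⁻¹ * Bᵀ) *ᵥ h t

variable {A Q P : Matrix ι ι ℝ} {B : Matrix ι κ ℝ} {Θ : Matrix κ κ ℝ} {f h : ℝ → ι → ℝ}
  {s : ℝ → ℝ}

theorem dotProduct_sub_optimalControl (hΘ : Θ.PosDef) (x : ι → ℝ) (t : ℝ) (v : κ → ℝ) :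
    (v - optimalControl B Θ P h x t) ⬝ᵥ Θ *ᵥ (v - optimalControl B Θ P h x t) =
      v ⬝ᵥ Θ *ᵥ v + 2 * ((B *ᵥ v) ⬝ᵥ (P *ᵥ x + h t)) +
        (P *ᵥ x + h t) ⬝ᵥ (B * Θ⁻¹ * Bᵀ) *ᵥ (P *ᵥ x + h t) := by
  have hu : IsUnit Θ.det := (Matrix.isUnit_iff_isUnit_det Θ).1 hΘ.isUnit
  have hs : Θᵀ = Θ := (posSemidef_iff_real.1 hΘ.posSemidef).1
  set y := P *ᵥ x + h t with hy
  have e1 : optimalControl B Θ P h x t = -(Θ⁻¹ *ᵥ (Bᵀ *ᵥ y)) := by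
    simp only [optimalControl, gain, hy, Matrix.neg_mulVec, Matrix.mulVec_add,
      Matrix.mulVec_mulVec, Matrix.mul_assoc]
    abel
  have e2 : Θ *ᵥ (Θ⁻¹ *ᵥ (Bᵀ *ᵥ y)) = Bᵀ *ᵥ y := by
    rw [Matrix.mulVec_mulVec, Matrix.mul_nonsing_inv _ hu, Matrix.one_mulVec]
  rw [e1, sub_neg_eq_add, Matrix.mulVec_add Θ, e2, dotProduct_add, add_dotProduct, add_dotProduct,
    dotProduct_mulVec_comm hs (Θ⁻¹ *ᵥ (Bᵀ *ᵥ y)) v, e2, dotProduct_transpose_mulVec,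
    dotProduct_transpose_mulVec,
    dotProduct_comm _ y, Matrix.mulVec_mulVec, Matrix.mulVec_mulVec]
  rw [dotProduct_comm _ y, Matrix.mul_assoc]
  ring

/-- Completion of squares: along a controlled trajectory, the derivative of
`xᵀPx + 2hᵀx + s` is the negative of the running cost, plus the square of the deviation of the
control from the candidate optimal one. -/
theorem hasDerivAt_value (hΘ : Θ.PosDef) (hP : Pᵀ = P) (hR : riccati A B Q Θ P = 0)
    {x : ℝ → ι → ℝ} {v : κ → ℝ} {t : ℝ}
    (hh : HasDerivAt h (-((A - B * Θ⁻¹ * Bᵀ * P)ᵀ *ᵥ h t) - P *ᵥ f t) t)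
    (hs : HasDerivAt s (-2 * (h t ⬝ᵥ f t) + h t ⬝ᵥ (B * Θ⁻¹ * Bᵀ) *ᵥ h t) t)
    (hx : HasDerivAt x (A *ᵥ x t + B *ᵥ v + f t) t) :
    HasDerivAt (fun t => x t ⬝ᵥ P *ᵥ x t + 2 * (h t ⬝ᵥ x t) + s t)
      ((v - optimalControl B Θ P h (x t) t) ⬝ᵥ Θ *ᵥ (v - optimalControl B Θ P h (x t) t) -
        (x t ⬝ᵥ Q *ᵥ x t + v ⬝ᵥ Θ *ᵥ v)) t := by
  have hΘs : Θᵀ = Θ := (posSemidef_iff_real.1 hΘ.posSemidef).1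
  refine (((hx.dotProduct (hx.matrix_mulVec P)).add ((hh.dotProduct hx).const_mul 2)).add
    hs).congr_deriv ?_
  have hS : (B * Θ⁻¹ * Bᵀ)ᵀ = B * Θ⁻¹ * Bᵀ := by
    simp [Matrix.transpose_mul, Matrix.transpose_nonsing_inv, hΘs, Matrix.mul_assoc]
  rw [dotProduct_sub_optimalControl hΘ]
  set S := B * Θ⁻¹ * Bᵀ with hSdef
  have hric := congrArg (fun Y : Matrix ι ι ℝ => x t ⬝ᵥ Y *ᵥ x t) hR
  simp only [riccati, ← hSdef, Matrix.add_mulVec, Matrix.sub_mulVec, dotProduct_add,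
    dotProduct_sub, ← Matrix.mulVec_mulVec, Matrix.zero_mulVec, dotProduct_zero,
    dotProduct_transpose_mulVec] at hric
  rw [dotProduct_mulVec_comm hP (x t) (A *ᵥ x t), dotProduct_mulVec_comm hP (x t),
    dotProduct_comm (S *ᵥ _)] at hric
  rw [dotProduct_mulVec_comm hP (x t)]
  simp only [add_dotProduct, dotProduct_add, sub_dotProduct, neg_dotProduct, Matrix.mulVec_add]
  rw [dotProduct_comm _ (x t), dotProduct_transpose_mulVec, Matrix.sub_mulVec,
    ← Matrix.mulVec_mulVec, sub_dotProduct, dotProduct_comm (P *ᵥ f t),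
    dotProduct_mulVec_comm hP (x t) (f t), dotProduct_mulVec_comm hS (P *ᵥ x t) (h t),
    dotProduct_comm (A *ᵥ x t) (h t), dotProduct_comm (S *ᵥ _) (h t),
    dotProduct_comm (B *ᵥ v) (h t)]
  linarith

/-- The cost of an arbitrary square-integrable open-loop control is the value
`xᵀPx + 2hᵀx + s` at time `0`, plus the integrated square of the deviation from the candidate
optimal control. -/
theorem integral_cost_eq (hΘ : Θ.PosDef) (hP : Pᵀ = P) (hR : riccati A B Q Θ P = 0)
    (hh : LocAC h) (hh' : ∀ᵐ t ∂(volume.restrict (Ici (0 : ℝ))),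
      HasDerivAt h (-((A - B * Θ⁻¹ * Bᵀ * P)ᵀ *ᵥ h t) - P *ᵥ f t) t) (hhd : ExpDecay h)
    (hs : LocAC s) (hs' : ∀ᵐ t ∂(volume.restrict (Ici (0 : ℝ))),
      HasDerivAt s (-2 * (h t ⬝ᵥ f t) + h t ⬝ᵥ (B * Θ⁻¹ * Bᵀ) *ᵥ h t) t)
    (hsl : Tendsto s atTop (𝓝 0)) {x : ℝ → ι → ℝ} {v : ℝ → κ → ℝ} (hx : LocAC x)
    (hx' : ∀ᵐ t ∂(volume.restrict (Ici (0 : ℝ))), HasDerivAt x (A *ᵥ x t + B *ᵥ v t + f t) t)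
    (hx2 : MemLp x 2 (volume.restrict (Ici (0 : ℝ))))
    (hv2 : MemLp v 2 (volume.restrict (Ici (0 : ℝ)))) :
    ∫ t in Ici (0 : ℝ), (x t ⬝ᵥ Q *ᵥ x t + v t ⬝ᵥ Θ *ᵥ v t) =
      x 0 ⬝ᵥ P *ᵥ x 0 + 2 * (h 0 ⬝ᵥ x 0) + s 0 +
        ∫ t in Ici (0 : ℝ), (v t - optimalControl B Θ P h (x t) t) ⬝ᵥ
          Θ *ᵥ (v t - optimalControl B Θ P h (x t) t) := by
  have hw2 : MemLp (fun t => v t - optimalControl B Θ P h (x t) t) 2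
      (volume.restrict (Ici (0 : ℝ))) :=
    hv2.sub ((hx2.matrix_mulVec (gain B Θ P)).add
      (hhd.memLp_two.matrix_mulVec (-(Θ⁻¹ * Bᵀ))))
  have hcost : Integrable (fun t => x t ⬝ᵥ Q *ᵥ x t + v t ⬝ᵥ Θ *ᵥ v t)
      (volume.restrict (Ici (0 : ℝ))) :=
    (hx2.integrable_dotProduct (hx2.matrix_mulVec Q)).add
      (hv2.integrable_dotProduct (hv2.matrix_mulVec Θ))
  have hsq := hw2.integrable_dotProduct (hw2.matrix_mulVec Θ)
  let V : ℝ → ℝ := fun t => x t ⬝ᵥ P *ᵥ x t + 2 * (h t ⬝ᵥ x t) + s t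
  have hVac : LocAC V := LocAC.add (LocAC.add (hx.dotProduct (hx.mulVec P))
    fun T hT => (hh.dotProduct hx T hT).const_mul 2) hs
  have hVd : ∀ᵐ t ∂(volume.restrict (Ici (0 : ℝ))), HasDerivAt V
      ((v t - optimalControl B Θ P h (x t) t) ⬝ᵥ
        Θ *ᵥ (v t - optimalControl B Θ P h (x t) t) -
        (x t ⬝ᵥ Q *ᵥ x t + v t ⬝ᵥ Θ *ᵥ v t)) t := by
    filter_upwards [hh', hs', hx'] with t h1 h2 h3 using hasDerivAt_value hΘ hP hR h1 h2 h3
  have hlim : Tendsto V atTop (𝓝 (V 0 + ∫ t in Ici (0 : ℝ),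
      ((v t - optimalControl B Θ P h (x t) t) ⬝ᵥ
        Θ *ᵥ (v t - optimalControl B Θ P h (x t) t) -
        (x t ⬝ᵥ Q *ᵥ x t + v t ⬝ᵥ Θ *ᵥ v t)))) := by
    rw [integral_Ici_eq_integral_Ioi]
    refine ((intervalIntegral_tendsto_integral_Ioi 0 (IntegrableOn.mono_set (hsq.sub hcost)
      Ioi_subset_Ici_self) tendsto_id).const_add (V 0)).congr' ?_
    filter_upwards [eventually_ge_atTop 0] with t ht
    have := hVac.integral_eq_sub hVd ht
    simp only [id]
    rw [Pi.sub_def, this]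
    ring
  -- The quadratic part of `V` is integrable and convergent, so that its limit is zero.
  have hint : IntegrableOn (fun t => V t - s t) (Ici 0) := by
    refine (((hx2.integrable_dotProduct (hx2.matrix_mulVec P)).add
      ((hhd.memLp_two.integrable_dotProduct hx2).const_mul 2))).congr (Eventually.of_forall ?_)
    intro t
    simp [V]
  have hzero := IntegrableAtFilter.eq_zero_of_tendsto (l := atTop) (μ := volume)
    ⟨Ici 0, Ici_mem_atTop 0, hint⟩ (fun u hu => by
      obtain ⟨a, ha⟩ := mem_atTop_sets.1 hu
      exact measure_mono_top (s₁ := Ici a) (fun b hb => ha b hb) Real.volume_Ici)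
    (hlim.sub hsl)
  rw [integral_sub hsq hcost, sub_zero] at hzero
  have hV0 : V 0 = x 0 ⬝ᵥ P *ᵥ x 0 + 2 * (h 0 ⬝ᵥ x 0) + s 0 := rfl
  rw [← hV0]
  linarith

end Value

/-! ### Affine state feedbacks -/

namespace LQProblem

variable {ι κ : Type*} [Fintype ι] [Fintype κ] {L : LQProblem ι κ}

theorem IsTrajectory.memLp {u : (ι → ℝ) → ℝ → κ → ℝ} {z : ℝ → ι → ℝ} (hz : L.IsTrajectory u z)
    (hu : L.IsAdmissible u) : MemLp z 2 (volume.restrict (Ici (0 : ℝ))) ∧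
      MemLp (fun t => u (z t) t) 2 (volume.restrict (Ici (0 : ℝ))) := by
  obtain ⟨-, z', -, huniq, h1, h2⟩ := hu
  have he : ∀ᵐ t ∂(volume.restrict (Ici (0 : ℝ))), z' t = z t := by
    rw [ae_restrict_iff' measurableSet_Ici]
    exact Eventually.of_forall fun t ht => (huniq z hz ht).symm
  refine ⟨h1.ae_eq he, h2.ae_eq ?_⟩
  filter_upwards [he] with t ht
  rw [ht]

/-- The affine feedback with gain `K` and time-dependent offset `k`. -/
def affineFeedback (K : Matrix κ ι ℝ) (k : ℝ → κ → ℝ) (w : ι → ℝ) (t : ℝ) : κ → ℝ := K *ᵥ w + k t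

theorem isFeedback_affineFeedback (K : Matrix κ ι ℝ) {k : ℝ → κ → ℝ} (hk : ExpDecay k) :
    IsFeedback (affineFeedback K k) := by
  refine ⟨fun w => aestronglyMeasurable_const.add hk.1, fun w₀ =>
    ⟨‖LinearMap.toContinuousLinearMap K.mulVecLin‖₊, univ, univ_mem, fun t _ => ?_⟩⟩
  refine LipschitzWith.lipschitzOnWith (LipschitzWith.of_dist_le_mul fun w w' => ?_)
  simp only [affineFeedback, dist_add_right]
  exact (LinearMap.toContinuousLinearMap K.mulVecLin).lipschitz.dist_le_mul w w'

theorem exists_trajectory_affineFeedback [DecidableEq ι] {K : Matrix κ ι ℝ} {k : ℝ → κ → ℝ}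
    (hK : IsHurwitz (L.A + L.B * K)) (hk : ExpDecay k) (hf : ExpDecay L.f) :
    L.IsAdmissible (affineFeedback K k) ∧ ∃ z, L.IsTrajectory (affineFeedback K k) z := by
  have hg : ExpDecay fun t => L.B *ᵥ k t + L.f t := (hk.mulVec L.B).add hf
  have hgi := IntegrableOn.intervalIntegrable_zero hg.integrableOn
  have hrhs : ∀ (w : ι → ℝ) (t : ℝ), L.A *ᵥ w + L.B *ᵥ affineFeedback K k w t + L.f t =
      (L.A + L.B * K) *ᵥ w + (L.B *ᵥ k t + L.f t) := fun w t => by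
    simp only [affineFeedback, Matrix.mulVec_add, Matrix.add_mulVec, Matrix.mulVec_mulVec]
    abel
  let z := duhamel (L.A + L.B * K) (fun t => L.B *ᵥ k t + L.f t) L.z0
  have hz : L.IsTrajectory (affineFeedback K k) z := by
    refine ⟨locAC_duhamel hgi, duhamel_zero, ?_⟩
    filter_upwards [hasDerivAt_duhamel (x₀ := L.z0) hgi] with t ht
    rw [hrhs]
    exact ht
  have hzd : ExpDecay z := hK.expDecay_duhamel hg L.z0
  refine ⟨⟨isFeedback_affineFeedback K hk, z, hz, fun z' hz' t ht => ?_, hzd.memLp_two,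
    ((hzd.mulVec K).add hk).memLp_two⟩, z, hz⟩
  have hd : ∀ w, L.IsTrajectory (affineFeedback K k) w →
      ∀ᵐ t ∂(volume.restrict (Ici (0 : ℝ))), HasDerivAt w
        ((L.A + L.B * K) *ᵥ w t + (L.B *ᵥ k t + L.f t)) t := fun w hw => by
    filter_upwards [hw.2.2] with t ht
    rwa [hrhs] at ht
  have h := hz'.1.sub_eq_flow hz.1 (hd z' hz') (hd z hz) ht
  rw [hz'.2.1, hz.2.1, sub_self, map_zero] at h
  exact sub_eq_zero.1 h

/-- A regular stationary problem: the candidate optimal control is admissible, and its cost is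
minimal. -/
theorem isLeast_costValues [DecidableEq ι] [DecidableEq κ] (hf : ExpDecay L.f)
    (hΘ : L.R.PosDef) {P : Matrix ι ι ℝ}
    (hP : Pᵀ = P) (hR : riccati L.A L.B L.Q L.R P = 0)
    (hH : IsHurwitz (L.A + L.B * gain L.B L.R P)) {h : ℝ → ι → ℝ} {s : ℝ → ℝ}
    (hh : LocAC h) (hh' : ∀ᵐ t ∂(volume.restrict (Ici (0 : ℝ))),
      HasDerivAt h (-((L.A - L.B * L.R⁻¹ * L.Bᵀ * P)ᵀ *ᵥ h t) - P *ᵥ L.f t) t)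
    (hhd : ExpDecay h) (hs : LocAC s) (hs' : ∀ᵐ t ∂(volume.restrict (Ici (0 : ℝ))),
      HasDerivAt s (-2 * (h t ⬝ᵥ L.f t) + h t ⬝ᵥ (L.B * L.R⁻¹ * L.Bᵀ) *ᵥ h t) t)
    (hsl : Tendsto s atTop (𝓝 0)) :
    IsLeast L.costValues (L.z0 ⬝ᵥ P *ᵥ L.z0 + 2 * (h 0 ⬝ᵥ L.z0) + s 0) := by
  constructor
  · obtain ⟨hadm, z, hz⟩ := exists_trajectory_affineFeedback (L := L) hH
      (hhd.mulVec (-(L.R⁻¹ * L.Bᵀ))) hf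
    refine ⟨_, z, hadm, hz, ?_⟩
    obtain ⟨h1, h2⟩ := hz.memLp hadm
    rw [cost, integral_cost_eq hΘ hP hR hh hh' hhd hs hs' hsl hz.1 hz.2.2 h1 h2, hz.2.1]
    simp [optimalControl, affineFeedback]
  · rintro c ⟨u, z, hadm, hz, rfl⟩
    obtain ⟨h1, h2⟩ := hz.memLp hadm
    rw [cost, integral_cost_eq hΘ hP hR hh hh' hhd hs hs' hsl hz.1 hz.2.2 h1 h2, hz.2.1]
    exact le_add_of_nonneg_right
      (integral_nonneg fun t => (posSemidef_iff_real.1 hΘ.posSemidef).2 _)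

end LQProblem

/-! ### Block structure of the transformed singular problem -/

theorem ExpDecay.comp_index {ι κ : Type*} [Fintype ι] [Fintype κ] {f : ℝ → ι → ℝ}
    (hf : ExpDecay f) (g : κ → ι) : ExpDecay fun t => f t ∘ g :=
  hf.clm (ContinuousLinearMap.pi fun k => ContinuousLinearMap.proj (R := ℝ) (g k))

theorem LocAC.comp_index {ι κ : Type*} [Fintype ι] [Fintype κ] {z : ℝ → ι → ℝ} (hz : LocAC z)
    (g : κ → ι) : LocAC fun t => z t ∘ g :=
  locAC_pi fun k => hz.apply (g k)

theorem hasDerivAt_comp_index {ι κ : Type*} [Fintype ι] [Fintype κ] {z : ℝ → ι → ℝ} {z' : ι → ℝ}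
    {t : ℝ} (hz : HasDerivAt z z' t) (g : κ → ι) : HasDerivAt (fun t => z t ∘ g) (z' ∘ g) t :=
  hasDerivAt_pi.2 fun k => hasDerivAt_pi.1 hz (g k)

theorem dotProduct_fromBlocks_diag {ι κ : Type*} [Fintype ι] [Fintype κ] (M : Matrix ι ι ℝ)
    (N : Matrix κ κ ℝ) (z w : ι ⊕ κ → ℝ) :
    z ⬝ᵥ Matrix.fromBlocks M 0 0 N *ᵥ w =
      (z ∘ Sum.inl) ⬝ᵥ M *ᵥ (w ∘ Sum.inl) + (z ∘ Sum.inr) ⬝ᵥ N *ᵥ (w ∘ Sum.inr) := by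
  rw [Matrix.fromBlocks_mulVec]
  simp [dotProduct, Fintype.sum_sum_type]

/-- Closed-loop stability for the feedback that drives `y - K x` to zero at rate `c` while the
system with `y = K x` is stable. -/
theorem isHurwitz_fromBlocks {ι κ : Type*} [Fintype ι] [DecidableEq ι] [Fintype κ] [DecidableEq κ]
    {M : Matrix ι ι ℝ} {N : Matrix ι κ ℝ} {K : Matrix κ ι ℝ} (h : IsHurwitz (M + N * K)) {c : ℝ}
    (hc : 0 < c) :
    IsHurwitz (Matrix.fromBlocks M N (K * M + c • K) (K * N - c • (1 : Matrix κ κ ℝ))) := by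
  rw [isHurwitz_iff] at h ⊢
  intro σ ω a b hσ ha hb
  rw [Matrix.fromBlocks_mulVec] at ha hb
  have ha1 : M *ᵥ (a ∘ Sum.inl) + N *ᵥ (a ∘ Sum.inr) = σ • (a ∘ Sum.inl) - ω • (b ∘ Sum.inl) :=
    funext fun i => congrFun ha (Sum.inl i)
  have hb1 : M *ᵥ (b ∘ Sum.inl) + N *ᵥ (b ∘ Sum.inr) = ω • (a ∘ Sum.inl) + σ • (b ∘ Sum.inl) :=
    funext fun i => congrFun hb (Sum.inl i)
  have ha2 : (K * M + c • K) *ᵥ (a ∘ Sum.inl) + (K * N - c • (1 : Matrix κ κ ℝ)) *ᵥ (a ∘ Sum.inr) =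
      σ • (a ∘ Sum.inr) - ω • (b ∘ Sum.inr) := funext fun i => congrFun ha (Sum.inr i)
  have hb2 : (K * M + c • K) *ᵥ (b ∘ Sum.inl) + (K * N - c • (1 : Matrix κ κ ℝ)) *ᵥ (b ∘ Sum.inr) =
      ω • (a ∘ Sum.inr) + σ • (b ∘ Sum.inr) := funext fun i => congrFun hb (Sum.inr i)
  suffices hs : (a ∘ Sum.inl = 0 ∧ a ∘ Sum.inr = 0) ∧ (b ∘ Sum.inl = 0 ∧ b ∘ Sum.inr = 0) by
    have h0 : ∀ v : ι ⊕ κ → ℝ, v ∘ Sum.inl = 0 ∧ v ∘ Sum.inr = 0 → v = 0 := fun v hv =>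
      funext fun i => i.rec (congrFun hv.1) (congrFun hv.2)
    exact ⟨h0 a hs.1, h0 b hs.2⟩
  generalize a ∘ Sum.inl = ax at *
  generalize a ∘ Sum.inr = ay at *
  generalize b ∘ Sum.inl = bx at *
  generalize b ∘ Sum.inr = bY at *
  have expand : ∀ x y, (K * M + c • K) *ᵥ x + (K * N - c • (1 : Matrix κ κ ℝ)) *ᵥ y =
      K *ᵥ (M *ᵥ x + N *ᵥ y) - c • (y - K *ᵥ x) := fun x y => by
    simp only [Matrix.add_mulVec, Matrix.sub_mulVec, Matrix.smul_mulVec, Matrix.one_mulVec,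
      Matrix.mulVec_add, Matrix.mulVec_mulVec, smul_sub]
    abel
  rw [expand, ha1] at ha2
  rw [expand, hb1] at hb2
  -- The deviations `e = y - K x` of the two parts satisfy `-c e = (σ + iω) e`.
  obtain ⟨ea, hea⟩ : ∃ ea, ay - K *ᵥ ax = ea := ⟨_, rfl⟩
  obtain ⟨eb, heb⟩ : ∃ eb, bY - K *ᵥ bx = eb := ⟨_, rfl⟩
  obtain rfl : ay = ea + K *ᵥ ax := by rw [← hea]; abel
  obtain rfl : bY = eb + K *ᵥ bx := by rw [← heb]; abel
  simp only [Matrix.mulVec_sub, Matrix.mulVec_add, Matrix.mulVec_smul,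
    add_sub_cancel_right] at ha2 hb2
  have h1 : ∀ i, -(c * ea i) = σ * ea i - ω * eb i := fun i => by
    have := congrFun ha2 i
    simp only [Pi.sub_apply, Pi.smul_apply, Pi.add_apply, smul_eq_mul] at this
    linarith
  have h2 : ∀ i, -(c * eb i) = ω * ea i + σ * eb i := fun i => by
    have := congrFun hb2 i
    simp only [Pi.sub_apply, Pi.smul_apply, Pi.add_apply, smul_eq_mul] at this
    linarith
  have h3 : ∀ i, ea i = 0 ∧ eb i = 0 := fun i => by
    have h4 : (c + σ) * (ea i ^ 2 + eb i ^ 2) = 0 := by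
      linear_combination (-ea i) * h1 i - eb i * h2 i
    have h5 : ea i ^ 2 + eb i ^ 2 = 0 := (mul_eq_zero.1 h4).resolve_left (by positivity)
    constructor <;> nlinarith [sq_nonneg (ea i), sq_nonneg (eb i)]
  have hea0 : ea = 0 := funext fun i => (h3 i).1
  have heb0 : eb = 0 := funext fun i => (h3 i).2
  subst hea0 heb0
  obtain ⟨rfl, rfl⟩ := h σ ω ax bx hσ
    (by rw [← ha1]; simp [Matrix.add_mulVec, Matrix.mulVec_mulVec])
    (by rw [← hb1]; simp [Matrix.add_mulVec, Matrix.mulVec_mulVec])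
  simp

namespace Data

variable {m q p : ℕ} (d : Data m q p)

/-- The matrix `(0; I_q)` through which the regular controls act on the slow state. -/
def regB (m q : ℕ) : Matrix (XIdx m q) (Fin q) ℝ :=
  Matrix.fromRows (0 : Matrix (Fin m) (Fin q) ℝ) 1

/-- Lower left block of `A`. -/
def A3 : Matrix (Fin p) (XIdx m q) ℝ := d.A.toBlocks₂₁

/-- Lower right block of `A`. -/
def A4 : Matrix (Fin p) (Fin p) ℝ := d.A.toBlocks₂₂

/-- Lower block of the disturbance `f`. -/
def f2 (t : ℝ) : Fin p → ℝ := d.f t ∘ Sum.inr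

theorem A_eq : d.A = Matrix.fromBlocks d.A1 d.A2 d.A3 d.A4 := (Matrix.fromBlocks_toBlocks _).symm

theorem tildeBc_mul_regB : d.tildeBc * regB m q = d.calB1 := by
  rw [tildeBc, regB, Matrix.fromCols_mul_fromRows]
  simp

theorem B_eq (h : IsUnit d.T.det) :
    d.B = Matrix.fromBlocks (regB m q) 0 (d.calH * regB m q) 1 := by
  have h1 : d.T * Matrix.fromBlocks (regB m q) 0 (d.calH * regB m q) 1 = d.calB := by
    rw [T, Matrix.fromCols_mul_fromBlocks, calL, Matrix.sub_mul, tildeBc_mul_regB]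
    simp only [Matrix.mul_assoc, sub_add_cancel, Matrix.mul_zero, Matrix.mul_one, zero_add]
    exact Matrix.fromCols_toCols _
  rw [B, ← h1, Matrix.nonsing_inv_mul_cancel_left _ _ h]

theorem isUnit_det_T (h : d.fullB.det ≠ 0) : IsUnit d.T.det := by
  have h1 : d.T = d.fullB * Matrix.fromBlocks 1 0 (-d.calH) 1 := by
    rw [fullB, Matrix.fromCols_mul_fromBlocks, T, calL]
    simp [sub_eq_add_neg]
  rw [h1, Matrix.det_mul, Matrix.det_fromBlocks_zero₁₂]
  simpa using h

section

variable {d} (hA2 : d.calD.PosSemidef) (hA3 : ∀ k, 0 < d.g k)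
  (hA5 : (d.calB2ᵀ * d.calD * d.calB2).det ≠ 0)

include hA5 in
theorem calB2_mul_calD_mul_calL : d.calB2ᵀ * d.calD * d.calL = 0 := by
  have h1 : d.D2 * d.D2⁻¹ = 1 := Matrix.mul_nonsing_inv _ (isUnit_iff_ne_zero.2 hA5)
  have h2 : d.calB2ᵀ * d.calD * d.calB2 * d.calH = d.calB2ᵀ * d.calD * d.tildeBc := by
    have h3 : d.D2 * (d.D2⁻¹ * d.calB2ᵀ * d.calD * d.tildeBc) =
        d.D2 * d.D2⁻¹ * (d.calB2ᵀ * d.calD * d.tildeBc) := by simp only [Matrix.mul_assoc]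
    rw [h1, Matrix.one_mul] at h3
    exact h3
  rw [calL, Matrix.mul_sub, ← Matrix.mul_assoc _ d.calB2, h2, sub_self]

include hA2 hA5 in
theorem D_eq : d.D = Matrix.fromBlocks d.D1 0 0 d.D2 := by
  have h1 := calB2_mul_calD_mul_calL hA5
  have h2 : d.calLᵀ * d.calD * d.calB2 = 0 := by
    have := congrArg Matrix.transpose h1
    simpa [Matrix.transpose_mul, (posSemidef_iff_real.1 hA2).1, Matrix.mul_assoc] using this
  rw [D, T, Matrix.transpose_fromCols, Matrix.fromRows_mul, Matrix.fromRows_mul_fromCols, h1, h2]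
  rfl

include hA2 hA5 in
theorem posDef_D2 : d.D2.PosDef :=
  (posSemidef_transpose_mul_mul hA2 d.calB2).posDef_iff_isUnit.2
    ((Matrix.isUnit_iff_isUnit_det _).2 (isUnit_iff_ne_zero.2 hA5))

include hA2 hA3 hA5 in
theorem posDef_Theta : d.Theta.PosDef := by
  have hg : (Matrix.diagonal d.g).PosDef := Matrix.PosDef.diagonal hA3
  have hD := posDef_D2 hA2 hA5
  have hgn := (posSemidef_iff_real.1 hg.posSemidef)
  have hDn := (posSemidef_iff_real.1 hD.posSemidef)
  have hps : d.Theta.PosSemidef := by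
    refine posSemidef_iff_real.2 ⟨?_, fun x => ?_⟩
    · rw [Theta, Matrix.fromBlocks_transpose, hgn.1, hDn.1]
      simp
    · rw [Theta, dotProduct_fromBlocks_diag]
      exact add_nonneg (hgn.2 _) (hDn.2 _)
  refine hps.posDef_iff_isUnit.2 ((Matrix.isUnit_iff_isUnit_det _).2 ?_)
  rw [Theta, Matrix.det_fromBlocks_zero₁₂]
  exact IsUnit.mul ((Matrix.isUnit_iff_isUnit_det _).1 hg.isUnit)
    ((Matrix.isUnit_iff_isUnit_det _).1 hD.isUnit)

include hA2 hA3 hA5 in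
theorem S0_eq : d.S0 = d.barB * d.Theta⁻¹ * d.barBᵀ := by
  have hg : IsUnit (Matrix.diagonal d.g) := (Matrix.PosDef.diagonal hA3).isUnit
  have hD := (posDef_D2 hA2 hA5).isUnit
  rw [Theta, Matrix.inv_fromBlocks_zero₁₂_of_isUnit_iff _ _ _ (iff_of_true hg hD), barB,
    Matrix.transpose_fromCols, Matrix.fromCols_mul_fromBlocks, Matrix.fromCols_mul_fromRows,
    Matrix.transpose_fromRows, S0, S1, add_comm, Matrix.fromRows_mul, Matrix.mul_zero,
    Matrix.mul_zero]
  simp only [Matrix.transpose_zero, Matrix.transpose_one, Matrix.zero_mul, Matrix.one_mul]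
  congr 1
  · rw [neg_zero, Matrix.mul_zero, add_zero, Matrix.fromRows_mul_fromCols]
    simp
  · rw [zero_add]

include hA2 hA5 in
/-- The cost of the singular problem is that of the reduced problem when the fast state `y` is
regarded as a control in place of the singular control. -/
theorem oocp_cost_eq (z : ZIdx m q p → ℝ) (u : UIdx q p → ℝ) :
    z ⬝ᵥ d.D *ᵥ z + u ⬝ᵥ d.G *ᵥ u = (z ∘ Sum.inl) ⬝ᵥ d.D1 *ᵥ (z ∘ Sum.inl) +
      Sum.elim (u ∘ Sum.inl) (z ∘ Sum.inr) ⬝ᵥ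
        d.Theta *ᵥ Sum.elim (u ∘ Sum.inl) (z ∘ Sum.inr) := by
  have hG : d.G = Matrix.fromBlocks (Matrix.diagonal d.g) 0 0 0 := by
    rw [G, ← Matrix.fromBlocks_diagonal]
    simp
  rw [D_eq hA2 hA5, hG, Theta, dotProduct_fromBlocks_diag, dotProduct_fromBlocks_diag,
    dotProduct_fromBlocks_diag]
  simp only [Sum.elim_comp_inl, Sum.elim_comp_inr, Matrix.zero_mulVec, dotProduct_zero]
  ring

end

theorem oocp_rhs_inl (h : IsUnit d.T.det) (z : ZIdx m q p → ℝ) (u : UIdx q p → ℝ) (t : ℝ) :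
    (d.A *ᵥ z + d.B *ᵥ u + d.f t) ∘ Sum.inl = d.A1 *ᵥ (z ∘ Sum.inl) +
      d.barB *ᵥ Sum.elim (u ∘ Sum.inl) (z ∘ Sum.inr) + d.f1 t := by
  rw [A_eq, B_eq d h, Matrix.fromBlocks_mulVec, Matrix.fromBlocks_mulVec, barB,
    Matrix.fromCols_mulVec_sumElim]
  ext i
  simp only [Function.comp_apply, Pi.add_apply, Sum.elim_inl, Matrix.zero_mulVec, Pi.zero_apply,
    f1, regB]
  ring

theorem oocp_rhs_inr (h : IsUnit d.T.det) (z : ZIdx m q p → ℝ) (u : UIdx q p → ℝ) (t : ℝ) :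
    (d.A *ᵥ z + d.B *ᵥ u + d.f t) ∘ Sum.inr = d.A3 *ᵥ (z ∘ Sum.inl) + d.A4 *ᵥ (z ∘ Sum.inr) +
      (d.calH * regB m q) *ᵥ (u ∘ Sum.inl) + u ∘ Sum.inr + d.f2 t := by
  rw [A_eq, B_eq d h, Matrix.fromBlocks_mulVec, Matrix.fromBlocks_mulVec]
  ext i
  simp only [Function.comp_apply, Pi.add_apply, Sum.elim_inr, Matrix.one_mulVec, f2]
  ring

end Data

namespace Data

variable {m q p : ℕ} (d : Data m q p)

/-! ### The singular problem as a reduced problem -/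

/-- The control of the reduced problem that belongs to a control `u` and a trajectory `z` of the
singular one: the regular controls together with the fast state. -/
def reducedControl (u : (ZIdx m q p → ℝ) → ℝ → UIdx q p → ℝ) (z : ℝ → ZIdx m q p → ℝ) (t : ℝ) :
    UIdx q p → ℝ :=
  Sum.elim (u (z t) t ∘ Sum.inl) (z t ∘ Sum.inr)

variable {d}

theorem memLp_reducedControl {u : (ZIdx m q p → ℝ) → ℝ → UIdx q p → ℝ} {z : ℝ → ZIdx m q p → ℝ}
    (hz : MemLp z 2 (volume.restrict (Ici (0 : ℝ))))
    (hu : MemLp (fun t => u (z t) t) 2 (volume.restrict (Ici (0 : ℝ)))) :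
    MemLp (reducedControl u z) 2 (volume.restrict (Ici (0 : ℝ))) :=
  MemLp.of_eval fun i => i.rec (fun i => hu.eval (Sum.inl i)) (fun i => hz.eval (Sum.inr i))

/-- The cost of an admissible trajectory of the singular problem is the value of the reduced problem
plus a nonnegative term, the integrated square of the deviation of `reducedControl` from the optimal
control of the reduced problem. -/
theorem oocp_cost_eq_value (hT : IsUnit d.T.det) (hA2 : d.calD.PosSemidef)
    (hA3 : ∀ k, 0 < d.g k) (hA5 : (d.calB2ᵀ * d.calD * d.calB2).det ≠ 0)
    {P : Matrix (XIdx m q) (XIdx m q) ℝ} {h : ℝ → XIdx m q → ℝ} {s : ℝ → ℝ}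
    (hP : d.IsRiccatiSol P) (hh : d.IsHSol P h) (hhd : ExpDecay h) (hs : d.IsSSol h s)
    {u : (ZIdx m q p → ℝ) → ℝ → UIdx q p → ℝ} {z : ℝ → ZIdx m q p → ℝ}
    (hu : d.oocp.IsAdmissible u) (hz : d.oocp.IsTrajectory u z) :
    d.oocp.cost u z = d.x0 ⬝ᵥ P *ᵥ d.x0 + 2 * (h 0 ⬝ᵥ d.x0) + s 0 +
      ∫ t in Ici (0 : ℝ), (reducedControl u z t -
          optimalControl d.barB d.Theta P h (z t ∘ Sum.inl) t) ⬝ᵥ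
        d.Theta *ᵥ (reducedControl u z t -
          optimalControl d.barB d.Theta P h (z t ∘ Sum.inl) t) := by
  obtain ⟨h1, h2⟩ := hz.memLp hu
  have hS := S0_eq hA2 hA3 hA5
  obtain ⟨hP1, hP2⟩ := hP
  obtain ⟨hh1, hh2, -⟩ := hh
  obtain ⟨hs1, hs2, hs3⟩ := hs
  rw [hS] at hP2
  simp only [hS] at hh2 hs2
  have hz0 : z 0 ∘ Sum.inl = d.x0 := by rw [hz.2.1]; rfl
  have hR : riccati d.A1 d.barB d.D1 d.Theta P = 0 := hP2
  rw [← hz0, ← integral_cost_eq (Q := d.D1) (f := d.f1) (posDef_Theta hA2 hA3 hA5)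
    (posSemidef_iff_real.1 hP1).1 hR hh1 hh2 hhd hs1 hs2 hs3 (hz.1.comp_index Sum.inl) ?_
    (MemLp.of_eval fun i => h1.eval (Sum.inl i)) (memLp_reducedControl h1 h2)]
  · refine integral_congr_ae (Eventually.of_forall fun t => ?_)
    exact oocp_cost_eq hA2 hA5 (z t) (u (z t) t)
  · filter_upwards [hz.2.2] with t ht
    have := hasDerivAt_comp_index ht (Sum.inl : XIdx m q → ZIdx m q p)
    rwa [show (d.oocp.A *ᵥ z t + d.oocp.B *ᵥ u (z t) t + d.oocp.f t) ∘ Sum.inl = _ from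
      oocp_rhs_inl d hT (z t) (u (z t) t) t] at this

/-! ### High-gain feedbacks for the singular problem -/

variable (d) in
/-- The gain of the optimal control of the reduced problem with respect to `h`. -/
def hGain : Matrix (UIdx q p) (XIdx m q) ℝ := -(d.Theta⁻¹ * d.barBᵀ)

variable (d) in
/-- The state gain of a feedback for the singular problem. The regular controls follow the optimal
control of the reduced problem. The singular controls steer the fast state so that its deviation
`e` from the second component of that optimal control satisfies `e' = -c e`. -/
def fastGain (P : Matrix (XIdx m q) (XIdx m q) ℝ) (c : ℝ) :
    Matrix (UIdx q p) (ZIdx m q p) ℝ :=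
  Matrix.fromBlocks (gain d.barB d.Theta P).toRows₁ 0
    (-d.A3 - d.calH * regB m q * (gain d.barB d.Theta P).toRows₁ +
      (gain d.barB d.Theta P).toRows₂ * (d.A1 + regB m q * (gain d.barB d.Theta P).toRows₁) +
      c • (gain d.barB d.Theta P).toRows₂)
    (-d.A4 + (gain d.barB d.Theta P).toRows₂ * d.A2 - c • (1 : Matrix (Fin p) (Fin p) ℝ))

variable (d) in
/-- The time-dependent offset of the feedback with gain `fastGain`. The lower block contains the
derivative of `h` with the disturbance left out, as this cancels against the one in the slow
state. -/
def fastOffset (P : Matrix (XIdx m q) (XIdx m q) ℝ) (h : ℝ → XIdx m q → ℝ) (c : ℝ) (t : ℝ) :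
    UIdx q p → ℝ :=
  Matrix.fromRows d.hGain.toRows₁ (-(d.calH * regB m q * d.hGain.toRows₁) +
      (gain d.barB d.Theta P).toRows₂ * regB m q * d.hGain.toRows₁ -
      d.hGain.toRows₂ * (d.A1 - d.S0 * P)ᵀ + c • d.hGain.toRows₂) *ᵥ h t +
    Matrix.fromBlocks 0 0 0 (-1 : Matrix (Fin p) (Fin p) ℝ) *ᵥ d.f t

theorem gain_eq (P : Matrix (XIdx m q) (XIdx m q) ℝ) : gain d.barB d.Theta P = d.hGain * P := by
  rw [gain, hGain, Matrix.neg_mul]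

theorem toRows₂_gain (P : Matrix (XIdx m q) (XIdx m q) ℝ) :
    (gain d.barB d.Theta P).toRows₂ = d.hGain.toRows₂ * P := by
  rw [gain_eq]
  rfl

theorem barB_mulVec_elim (a : Fin q → ℝ) (b : Fin p → ℝ) :
    d.barB *ᵥ Sum.elim a b = regB m q *ᵥ a + d.A2 *ᵥ b :=
  Matrix.fromCols_mulVec_sumElim _ _ _ _

theorem add_barB_mul_gain (P : Matrix (XIdx m q) (XIdx m q) ℝ) :
    d.A1 + d.barB * gain d.barB d.Theta P =
      d.A1 + regB m q * (gain d.barB d.Theta P).toRows₁ +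
        d.A2 * (gain d.barB d.Theta P).toRows₂ := by
  conv_lhs => rw [← Matrix.fromRows_toRows (gain d.barB d.Theta P)]
  rw [barB, Matrix.fromCols_mul_fromRows, add_assoc]
  rfl

theorem isHurwitz_fastGain (hT : IsUnit d.T.det) {P : Matrix (XIdx m q) (XIdx m q) ℝ}
    (hH : IsHurwitz (d.A1 + d.barB * gain d.barB d.Theta P)) {c : ℝ} (hc : 0 < c) :
    IsHurwitz (d.A + d.B * d.fastGain P c) := by
  rw [add_barB_mul_gain] at hH
  convert isHurwitz_fromBlocks hH hc using 1
  rw [A_eq, B_eq d hT, fastGain, Matrix.fromBlocks_multiply, Matrix.fromBlocks_add]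
  congr 1
  · simp
  · simp
  · simp only [Matrix.one_mul, Matrix.mul_add, Matrix.mul_assoc]
    abel
  · simp only [Matrix.one_mul, Matrix.mul_zero, zero_add]
    abel

theorem expDecay_fastOffset (hf : ExpDecay d.f) (P : Matrix (XIdx m q) (XIdx m q) ℝ)
    {h : ℝ → XIdx m q → ℝ} (hh : ExpDecay h) (c : ℝ) : ExpDecay (d.fastOffset P h c) :=
  (hh.mulVec _).add (hf.mulVec _)

theorem optimalControl_inl (P : Matrix (XIdx m q) (XIdx m q) ℝ) (h : ℝ → XIdx m q → ℝ)
    (x : XIdx m q → ℝ) (t : ℝ) : optimalControl d.barB d.Theta P h x t ∘ Sum.inl =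
      (gain d.barB d.Theta P).toRows₁ *ᵥ x + d.hGain.toRows₁ *ᵥ h t := rfl

theorem optimalControl_inr (P : Matrix (XIdx m q) (XIdx m q) ℝ) (h : ℝ → XIdx m q → ℝ)
    (x : XIdx m q → ℝ) (t : ℝ) : optimalControl d.barB d.Theta P h x t ∘ Sum.inr =
      (gain d.barB d.Theta P).toRows₂ *ᵥ x + d.hGain.toRows₂ *ᵥ h t := rfl

theorem fastFeedback_inl (P : Matrix (XIdx m q) (XIdx m q) ℝ) (h : ℝ → XIdx m q → ℝ) (c : ℝ)
    (w : ZIdx m q p → ℝ) (t : ℝ) :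
    LQProblem.affineFeedback (d.fastGain P c) (d.fastOffset P h c) w t ∘ Sum.inl =
      (gain d.barB d.Theta P).toRows₁ *ᵥ (w ∘ Sum.inl) + d.hGain.toRows₁ *ᵥ h t := by
  rw [LQProblem.affineFeedback, fastGain, fastOffset, Matrix.fromBlocks_mulVec,
    Matrix.fromBlocks_mulVec, Matrix.fromRows_mulVec]
  ext i
  simp

theorem fastFeedback_inr (P : Matrix (XIdx m q) (XIdx m q) ℝ) (h : ℝ → XIdx m q → ℝ) (c : ℝ)
    (w : ZIdx m q p → ℝ) (t : ℝ) :
    LQProblem.affineFeedback (d.fastGain P c) (d.fastOffset P h c) w t ∘ Sum.inr =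
      (-d.A3 - d.calH * regB m q * (gain d.barB d.Theta P).toRows₁ +
      (gain d.barB d.Theta P).toRows₂ * (d.A1 + regB m q * (gain d.barB d.Theta P).toRows₁) +
      c • (gain d.barB d.Theta P).toRows₂) *ᵥ (w ∘ Sum.inl) +
      (-d.A4 + (gain d.barB d.Theta P).toRows₂ * d.A2 - c • (1 : Matrix (Fin p) (Fin p) ℝ)) *ᵥ
        (w ∘ Sum.inr) + ((-(d.calH * regB m q * d.hGain.toRows₁) +
      (gain d.barB d.Theta P).toRows₂ * regB m q * d.hGain.toRows₁ -
      d.hGain.toRows₂ * (d.A1 - d.S0 * P)ᵀ + c • d.hGain.toRows₂) *ᵥ h t - d.f2 t) := by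
  rw [LQProblem.affineFeedback, fastGain, fastOffset, Matrix.fromBlocks_mulVec,
    Matrix.fromBlocks_mulVec, Matrix.fromRows_mulVec]
  ext i
  simp only [Function.comp_apply, Pi.add_apply, Sum.elim_inr, Matrix.zero_mulVec, Pi.zero_apply,
    Matrix.neg_mulVec, Matrix.one_mulVec, f2, Pi.sub_apply, Pi.neg_apply]
  ring

/-- Along the closed loop, the fast state relaxes exactly exponentially to the second component of
the optimal control of the reduced problem. -/
theorem fast_deviation_eq (hT : IsUnit d.T.det) {P : Matrix (XIdx m q) (XIdx m q) ℝ}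
    {h : ℝ → XIdx m q → ℝ} (hh : d.IsHSol P h) {c : ℝ} {z : ℝ → ZIdx m q p → ℝ}
    (hz : d.oocp.IsTrajectory
      (LQProblem.affineFeedback (d.fastGain P c) (d.fastOffset P h c)) z) {t : ℝ} (ht : 0 ≤ t) :
    z t ∘ Sum.inr - optimalControl d.barB d.Theta P h (z t ∘ Sum.inl) t ∘ Sum.inr =
      Real.exp (-(c * t)) • (d.z0 ∘ Sum.inr -
        optimalControl d.barB d.Theta P h d.x0 0 ∘ Sum.inr) := by
  let e : ℝ → Fin p → ℝ := fun t => z t ∘ Sum.inr -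
    ((gain d.barB d.Theta P).toRows₂ *ᵥ (z t ∘ Sum.inl) + d.hGain.toRows₂ *ᵥ h t)
  have heac : LocAC e := (hz.1.comp_index Sum.inr).sub
    (LocAC.add ((hz.1.comp_index Sum.inl).mulVec (gain d.barB d.Theta P).toRows₂)
      (hh.1.mulVec d.hGain.toRows₂))
  have hed : ∀ᵐ t ∂(volume.restrict (Ici (0 : ℝ))), HasDerivAt e (-c • e t) t := by
    filter_upwards [hz.2.2, hh.2.1] with t h1 h2
    have hx := hasDerivAt_comp_index h1 (Sum.inl : XIdx m q → ZIdx m q p)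
    have hy := hasDerivAt_comp_index h1 (Sum.inr : Fin p → ZIdx m q p)
    rw [show (d.oocp.A *ᵥ z t + d.oocp.B *ᵥ LQProblem.affineFeedback (d.fastGain P c)
      (d.fastOffset P h c) (z t) t + d.oocp.f t) ∘ Sum.inl = _ from
      oocp_rhs_inl d hT (z t) _ t, fastFeedback_inl, barB_mulVec_elim] at hx
    rw [show (d.oocp.A *ᵥ z t + d.oocp.B *ᵥ LQProblem.affineFeedback (d.fastGain P c)
      (d.fastOffset P h c) (z t) t + d.oocp.f t) ∘ Sum.inr = _ from
      oocp_rhs_inr d hT (z t) _ t, fastFeedback_inl, fastFeedback_inr] at hy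
    refine (hy.sub ((hx.matrix_mulVec (gain d.barB d.Theta P).toRows₂).add
      (h2.matrix_mulVec d.hGain.toRows₂))).congr_deriv ?_
    simp only [e, toRows₂_gain]
    generalize (gain d.barB d.Theta P).toRows₁ = K₁
    generalize d.hGain.toRows₁ = N₁
    generalize d.hGain.toRows₂ = N₂
    generalize z t ∘ Sum.inl = x
    generalize z t ∘ Sum.inr = y
    generalize regB m q = E
    generalize (d.A1 - d.S0 * P)ᵀ = M
    simp only [Matrix.add_mulVec, Matrix.sub_mulVec, Matrix.neg_mulVec, Matrix.smul_mulVec,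
      Matrix.one_mulVec, Matrix.mulVec_add, Matrix.mulVec_sub, Matrix.mulVec_neg,
      Matrix.mulVec_mulVec, Matrix.mul_add, Matrix.mul_assoc, smul_sub, smul_add, neg_smul]
    abel
  have hc : ContDiff ℝ 1 fun t : ℝ => Real.exp (c * t) := by fun_prop
  have h1 := ((ContDiff.locAC hc).smul heac).eq_of_ae_hasDerivAt_zero (by
    filter_upwards [hed] with t ht
    refine (((hasDerivAt_id t).const_mul c).exp.smul ht).congr_deriv ?_
    simp only [id, neg_smul, smul_neg, mul_one]
    rw [mul_smul, neg_add_cancel]) ht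
  simp only [mul_zero, Real.exp_zero, one_smul] at h1
  rw [optimalControl_inr, optimalControl_inr]
  have hz0 : z 0 = d.z0 := hz.2.1
  have h0 : e 0 = d.z0 ∘ Sum.inr -
      ((gain d.barB d.Theta P).toRows₂ *ᵥ d.x0 + d.hGain.toRows₂ *ᵥ h 0) := by
    simp only [e, hz0]
    rfl
  rw [← h0, ← h1, smul_smul, ← Real.exp_add, neg_add_cancel, Real.exp_zero, one_smul]

/-- The high-gain feedback exceeds the value of the reduced problem by a quantity of order
`1 / c`. -/
theorem mem_costValues_oocp (hT : IsUnit d.T.det) (hA2 : d.calD.PosSemidef)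
    (hA3 : ∀ k, 0 < d.g k) (hA5 : (d.calB2ᵀ * d.calD * d.calB2).det ≠ 0) (hf : ExpDecay d.f)
    {P : Matrix (XIdx m q) (XIdx m q) ℝ} {h : ℝ → XIdx m q → ℝ} {s : ℝ → ℝ}
    (hP : d.IsRiccatiSol P) (hH : IsHurwitz (d.A1 + d.barB * gain d.barB d.Theta P))
    (hh : d.IsHSol P h) (hhd : ExpDecay h) (hs : d.IsSSol h s) {c : ℝ} (hc : 0 < c) :
    d.x0 ⬝ᵥ P *ᵥ d.x0 + 2 * (h 0 ⬝ᵥ d.x0) + s 0 +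
      (d.z0 ∘ Sum.inr - optimalControl d.barB d.Theta P h d.x0 0 ∘ Sum.inr) ⬝ᵥ
        d.D2 *ᵥ (d.z0 ∘ Sum.inr - optimalControl d.barB d.Theta P h d.x0 0 ∘ Sum.inr) / (2 * c) ∈
      d.oocp.costValues := by
  obtain ⟨hadm, z, hz⟩ := LQProblem.exists_trajectory_affineFeedback (L := d.oocp)
    (isHurwitz_fastGain hT hH hc) (expDecay_fastOffset hf P hhd c) hf
  refine ⟨_, z, hadm, hz, ?_⟩
  rw [oocp_cost_eq_value hT hA2 hA3 hA5 hP hh hhd hs hadm hz]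
  congr 1
  set e := d.z0 ∘ Sum.inr - optimalControl d.barB d.Theta P h d.x0 0 ∘ Sum.inr with he
  have key : ∀ t ∈ Ici (0 : ℝ), (reducedControl (LQProblem.affineFeedback (d.fastGain P c)
        (d.fastOffset P h c)) z t - optimalControl d.barB d.Theta P h (z t ∘ Sum.inl) t) ⬝ᵥ
      d.Theta *ᵥ (reducedControl (LQProblem.affineFeedback (d.fastGain P c)
        (d.fastOffset P h c)) z t - optimalControl d.barB d.Theta P h (z t ∘ Sum.inl) t) =
      Real.exp (-(2 * c) * t) * (e ⬝ᵥ d.D2 *ᵥ e) := by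
    intro t ht
    rw [Theta, dotProduct_fromBlocks_diag]
    have h1 : (reducedControl (LQProblem.affineFeedback (d.fastGain P c)
        (d.fastOffset P h c)) z t - optimalControl d.barB d.Theta P h (z t ∘ Sum.inl) t) ∘ Sum.inl =
        0 := by
      change reducedControl _ z t ∘ Sum.inl - optimalControl d.barB d.Theta P h _ t ∘ Sum.inl = 0
      rw [reducedControl, Sum.elim_comp_inl, fastFeedback_inl, optimalControl_inl, sub_self]
    have h2 : (reducedControl (LQProblem.affineFeedback (d.fastGain P c)
        (d.fastOffset P h c)) z t - optimalControl d.barB d.Theta P h (z t ∘ Sum.inl) t) ∘ Sum.inr =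
        Real.exp (-(c * t)) • e := by
      change reducedControl _ z t ∘ Sum.inr - optimalControl d.barB d.Theta P h _ t ∘ Sum.inr = _
      rw [reducedControl, Sum.elim_comp_inr]
      exact fast_deviation_eq hT hh hz ht
    rw [← Theta, h1, h2, zero_dotProduct, zero_add, Matrix.mulVec_smul, smul_dotProduct,
      dotProduct_smul, smul_smul, ← Real.exp_add, smul_eq_mul]
    ring_nf
  rw [setIntegral_congr_fun measurableSet_Ici key, integral_mul_const, integral_Ici_eq_integral_Ioi,
    integral_exp_mul_Ioi (by linarith)]
  simp only [mul_zero, Real.exp_zero]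
  field_simp

end Data

end SingularLQ

end

open SingularLQ SingularLQ.Data in
theorem theorem1 {m q p l : ℕ} (hp : 0 < p) (d : SingularLQ.Data m q p)
    (hBc : d.fullB.det ≠ 0)
    (hA1 : d.calB.rank = q + p)
    (hA2 : d.calD.PosSemidef)
    (hA3 : ∀ k, 0 < d.g k)
    (hFmeas : AEStronglyMeasurable d.calF (volume.restrict (Ici (0 : ℝ))))
    (hA4 : ∃ a γ : ℝ, 0 < a ∧ 0 < γ ∧ ∀ t : ℝ, 0 ≤ t → ‖d.calF t‖ ≤ a * Real.exp (-γ * t))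
    (hA5 : (d.calB2ᵀ * d.calD * d.calB2).det ≠ 0)
    (hA6 : SingularLQ.IsStabilizable d.A1 d.barB)
    (F1 : Matrix (Fin l) (SingularLQ.XIdx m q) ℝ) (hF1 : d.D1 = F1ᵀ * F1)
    (hA7 : SingularLQ.IsDetectable d.A1 F1) :
    ∃ (P : Matrix (SingularLQ.XIdx m q) (SingularLQ.XIdx m q) ℝ)
      (h : ℝ → SingularLQ.XIdx m q → ℝ) (s : ℝ → ℝ),
      (d.IsRiccatiSol P ∧ ∀ P', d.IsRiccatiSol P' → P' = P) ∧
      SingularLQ.IsHurwitz (d.A1 - d.S0 * P) ∧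
      (d.IsHSol P h ∧ ∀ h', d.IsHSol P h' → EqOn h' h (Ici 0)) ∧
      (d.IsSSol h s ∧ ∀ s', d.IsSSol h s' → EqOn s' s (Ici 0)) ∧
      (d.oocp.costValues.Nonempty ∧ BddBelow d.oocp.costValues ∧
        sInf d.oocp.costValues = d.x0 ⬝ᵥ P *ᵥ d.x0 + 2 * (h 0 ⬝ᵥ d.x0) + s 0) ∧
      IsLeast d.rocp.costValues (d.x0 ⬝ᵥ P *ᵥ d.x0 + 2 * (h 0 ⬝ᵥ d.x0) + s 0) := by
  have hT := isUnit_det_T d hBc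
  have hΘ := posDef_Theta hA2 hA3 hA5
  have hS := S0_eq hA2 hA3 hA5
  have hf : ExpDecay d.f := ExpDecay.mulVec ⟨hFmeas, hA4⟩ d.T⁻¹
  have hf1 : ExpDecay d.f1 := hf.comp_index Sum.inl
  have hric : ∀ P, d.IsRiccatiSol P ↔
      P.PosSemidef ∧ riccati d.A1 d.barB (F1ᵀ * F1) d.Theta P = 0 := fun P => by
    rw [IsRiccatiSol, riccati, ← hF1, hS]
  obtain ⟨P, hP, hR⟩ := exists_riccati_eq_zero hΘ hA6 hA7
  have hPsol : d.IsRiccatiSol P := (hric P).2 ⟨hP, hR⟩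
  have hH := isHurwitz_of_riccati hΘ hA7 hP (by rw [hR, neg_zero]; exact Matrix.PosSemidef.zero)
  have hH' : IsHurwitz (d.A1 - d.S0 * P) := by rwa [add_mul_gain, ← hS] at hH
  obtain ⟨h, hh1, hh2, hhd⟩ := hH'.transpose.exists_expDecay_terminal (hf1.mulVec P)
  have hhs : d.IsHSol P h := ⟨hh1, hh2, hhd.tendsto⟩
  have hφ : ExpDecay fun t => -2 * (h t ⬝ᵥ d.f1 t) + h t ⬝ᵥ d.S0 *ᵥ h t :=
    ((hhd.dotProduct hf1).clm (ContinuousLinearMap.mul ℝ ℝ (-2))).add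
      (hhd.dotProduct (hhd.mulVec d.S0))
  obtain ⟨s, hs1, hs2, hs3⟩ := hφ.exists_primitive
  have hss : d.IsSSol h s := ⟨hs1, hs2, hs3⟩
  have hle : ∀ J ∈ d.oocp.costValues, d.x0 ⬝ᵥ P *ᵥ d.x0 + 2 * (h 0 ⬝ᵥ d.x0) + s 0 ≤ J := by
    rintro _ ⟨u, z, hu, hz, rfl⟩
    rw [oocp_cost_eq_value hT hA2 hA3 hA5 hPsol hhs hhd hss hu hz]
    exact le_add_of_nonneg_right
      (integral_nonneg fun t => (posSemidef_iff_real.1 hΘ.posSemidef).2 _)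
  have hmem := fun c (hc : 0 < c) =>
    mem_costValues_oocp hT hA2 hA3 hA5 hf hPsol hH hhs hhd hss (c := c) hc
  refine ⟨P, h, s, ⟨hPsol, fun P' hP' => ?_⟩, hH', ⟨hhs, fun h' hh' => ?_⟩,
    ⟨hss, fun s' hs' => ?_⟩, ⟨⟨_, hmem 1 one_pos⟩, ⟨_, hle⟩, ?_⟩, ?_⟩
  · obtain ⟨h1, h2⟩ := (hric P').1 hP'
    exact riccati_unique hΘ hA7 h1 hP h2 hR
  · exact hH'.transpose.terminal_unique hh1 hh'.1 hh2 hh'.2.1 hhd.tendsto hh'.2.2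
  · exact hs1.primitive_unique hs'.1 hs2 hs'.2.1 hs3 hs'.2.2
  · refine csInf_eq_of_forall_ge_of_forall_gt_exists_lt ⟨_, hmem 1 one_pos⟩ hle fun w hw => ?_
    -- The excess `E / (2c)` of the feedback with rate `c` tends to zero as `c → ∞`.
    have hlim : ∀ E V : ℝ, Tendsto (fun c : ℝ => V + E / (2 * c)) atTop (𝓝 V) := fun E V => by
      simpa using (((tendsto_id (α := ℝ)).const_mul_atTop two_pos).const_div_atTop E).const_add V
    obtain ⟨c, hc0, hc⟩ := ((eventually_gt_atTop 0).and ((hlim _ _).eventually_lt_const hw)).exists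
    exact ⟨_, hmem c hc0, hc⟩
  · simp only [hS] at hh2 hs2
    rw [← hF1] at hR
    exact LQProblem.isLeast_costValues (L := d.rocp) hf1 hΘ (posSemidef_iff_real.1 hP).1 hR hH
      hh1 hh2 hhd hs1 hs2 hs3
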